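/- Let $D^2$ be the closed unit disc with polar coordinates $(r,\theta)$, area form $\omega=2r\,dr\wedge d\theta$ and primitive $\lambda=r^2\,d\theta$. Diffeomorphisms of $D^2$ are smooth up to the boundary, and area-preserving means $\varphi^*\omega=\omega$. Write $S^1=\mathbb R/2\pi\mathbb Z$. *The cut construction.* Let $H_s\colon D^2\to\mathbb R$, $s\in S^1$, be a smooth $2\pi$-periodic Hamiltonian with $H_s|_{\partial D^2}\equiv h\in\mathbb N$ for all $s$, let $\lambda'$ be a smooth primitive of $\omega$ such that $\alpha=H_s\,ds+\lambda'$ is a positive contact form on $S^1\times D^2$ (oriented by $ds\wedge\omega$), and let $g$ be an area-preserving diffeomorphism of $D^2$, regarded also as a diffeomorphism of $S^1\times D^2$. Let $\psi$ be the time-$2\pi$ map of the Hamiltonian isotopy (starting at the identity) of the vector field $X_s$ given by $\omega(X_s,\cdot)=dH_s$. Put $Y=\partial_s-h\,\partial_\theta$, $B=\mathbb R/2\pi\mathbb Z$, and, for $(b;\rho e^{i\vartheta})\in B\times(\operatorname{Int}D^2_\delta\setminus\{0\})$ with $\delta\le1$, let $\Phi(b;\rho,\vartheta)$ be the point of $S^1\times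 D^2$ with $s=\vartheta$, $r=1-\rho^2$, $\theta=b-h\vartheta$. We say that $\psi$ *embeds by the cut construction*, starting from $\alpha$ and relative to $g$, if for some $\delta\in(0,1]$ the form $(g^{-1}\circ\Phi)^*\alpha$ extends to a smooth contact form on $B\times\operatorname{Int}D^2_\delta$. *Embedding into a Reeb flow.* An area-preserving diffeomorphism $\psi$ of $D^2$ *embeds into a Reeb flow on $S^3$* if there are a contact form $A$ on $S^3$ and a topological embedding $j\colon D^2\to S^3$, a smooth immersion on $\operatorname{Int}D^2$, whose image is a smoothly embedded closed disc with boundary $j(\partial D^2)$, such that $j(D^2)$ is a global surface of section for the Reeb flow of $A$ (the boundary is a periodic orbit, the interior is transverse to the Reeb vector field, and every orbit through a point outside the boundary meets the interior in forward and in backward time) and the Poincaré return map on the interior is $j\circ\psi\circ j^{-1}$. **Proposition.** Let $\psi$ be an area-preserving diffeomorphism of $D^2$ generated by a $2\pi$-periodic Hamiltonian $H_s$ with $H_s|_{\partial D^2}\equiv h\in\mathbb N$. Assume that $\psi$ embeds by the cut construction, starting from the contact form $H_s\,ds+\lambda$ and relative to $g=\mathrm{id}$. Let $\varphi$ be an area-preserving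 diffeomorphism of $D^2$. Then $\varphi^{-1}\circ\psi\circ\varphi$ likewise embeds into a Reeb flow on $S^3$. More precisely, there are a Hamiltonian $K_s$ with boundary value $h$ that generates $\varphi^{-1}\circ\psi\circ\varphi$, a primitive $\lambda'$ of $\omega$ and an area-preserving diffeomorphism $g$ of $D^2$ such that $\varphi^{-1}\circ\psi\circ\varphi$ embeds by the cut construction, starting from $\beta=K_s\,ds+\lambda'$ and relative to $g$; and there are a contact form $A$ on $S^3$ and a continuous surjection $q\colon S^1\times D^2\to S^3$ such that - $q$ collapses exactly the orbits of the circle action on $\partial(S^1\times D^2)$ generated by $g^*Y$, and is otherwise injective; - $q$ is a smooth immersion with $q^*A=\beta$ on $S^1\times\operatorname{Int}D^2$, and $q\circ g^{-1}\circ\Phi$ extends to a smooth immersion of $B\times\operatorname{Int}D^2_\delta$ into $S^3$ for some $\delta\in(0,1]$; - $q(\{0\}\times D^2)$ is a global surface of section for the Reeb flow of $A$ on which, in the parametrisation $j=q(0,\cdot)$ (which is as in the definition above), the return map is $\varphi^{-1}\circ\psi\circ\varphi$. -/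

import Mathlib

open Set
open scoped ContDiff

noncomputable section

namespace ReebCut

/-! ## The closed unit disc and its area-preserving diffeomorphisms -/

/-- The closed unit disc `D²` in `ℂ = ℝ²`. -/
def disc : Set ℂ := Metric.closedBall 0 1

/-- The interior of the disc. -/
def openDisc : Set ℂ := Metric.ball 0 1

/-- The boundary circle of the disc. -/
def circ : Set ℂ := Metric.sphere 0 1

/-- The area form `ω = 2 r dr ∧ dθ = 2 dx ∧ dy`. -/
def omega (u v : ℂ) : ℝ := 2 * (u.re * v.im - u.im * v.re)

theorem uniqueDiffOn_disc : UniqueDiffOn ℝ disc := by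
  refine uniqueDiffOn_convex (convex_closedBall 0 1) ?_
  rw [disc, interior_closedBall _ one_ne_zero]
  exact ⟨0, by simp⟩

/-- Area-preserving diffeomorphisms of the closed disc, smooth up to the boundary. The functions are
only relevant on `disc`. -/
structure AreaDiffeo where
  toFun : ℂ → ℂ
  invFun : ℂ → ℂ
  mapsTo : MapsTo toFun disc disc
  mapsTo_inv : MapsTo invFun disc disc
  left_inv : ∀ z ∈ disc, invFun (toFun z) = z
  right_inv : ∀ z ∈ disc, toFun (invFun z) = z
  smooth : ContDiffOn ℝ ∞ toFun disc
  smooth_inv : ContDiffOn ℝ ∞ invFun disc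
  area : ∀ z ∈ disc, ∀ u v : ℂ,
    omega (fderivWithin ℝ toFun disc z u) (fderivWithin ℝ toFun disc z v) = omega u v

instance : CoeFun AreaDiffeo (fun _ => ℂ → ℂ) := ⟨AreaDiffeo.toFun⟩

namespace AreaDiffeo

/-- The identity of the disc. -/
def refl : AreaDiffeo where
  toFun := id
  invFun := id
  mapsTo := fun _ h => h
  mapsTo_inv := fun _ h => h
  left_inv := fun _ _ => rfl
  right_inv := fun _ _ => rfl
  smooth := contDiffOn_id
  smooth_inv := contDiffOn_id
  area := by
    intro z hz u v
    rw [fderivWithin_id (uniqueDiffOn_disc z hz)]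
    rfl

/-- The inverse diffeomorphism. -/
def symm (f : AreaDiffeo) : AreaDiffeo where
  toFun := f.invFun
  invFun := f.toFun
  mapsTo := f.mapsTo_inv
  mapsTo_inv := f.mapsTo
  left_inv := f.right_inv
  right_inv := f.left_inv
  smooth := f.smooth_inv
  smooth_inv := f.smooth
  area := by
    intro z hz u v
    have hU := uniqueDiffOn_disc z hz
    have h1 : DifferentiableWithinAt ℝ f.invFun disc z :=
      (f.smooth_inv.differentiableOn (by simp)) z hz
    have h2 : DifferentiableWithinAt ℝ f.toFun disc (f.invFun z) :=
      (f.smooth.differentiableOn (by simp)) _ (f.mapsTo_inv hz)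
    have hc := fderivWithin_comp z h2 h1 f.mapsTo_inv hU
    have hid : fderivWithin ℝ (f.toFun ∘ f.invFun) disc z = ContinuousLinearMap.id ℝ ℂ := by
      have hcongr : fderivWithin ℝ (f.toFun ∘ f.invFun) disc z = fderivWithin ℝ id disc z :=
        fderivWithin_congr (fun x hx => f.right_inv x hx) (f.right_inv z hz)
      rw [hcongr]
      exact fderivWithin_id hU
    rw [hid] at hc
    have key : ∀ w : ℂ, fderivWithin ℝ f.toFun disc (f.invFun z)
        (fderivWithin ℝ f.invFun disc z w) = w := by
      intro w
      have := congrArg (fun L : ℂ →L[ℝ] ℂ => L w) hc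
      simpa using this.symm
    have := f.area _ (f.mapsTo_inv hz) (fderivWithin ℝ f.invFun disc z u)
      (fderivWithin ℝ f.invFun disc z v)
    rw [key, key] at this
    exact this.symm

/-- The composition `f ∘ g`. -/
def comp (f g : AreaDiffeo) : AreaDiffeo where
  toFun := f.toFun ∘ g.toFun
  invFun := g.invFun ∘ f.invFun
  mapsTo := f.mapsTo.comp g.mapsTo
  mapsTo_inv := g.mapsTo_inv.comp f.mapsTo_inv
  left_inv := by
    intro z hz
    simp [f.left_inv _ (g.mapsTo hz), g.left_inv z hz]
  right_inv := by
    intro z hz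
    simp [g.right_inv _ (f.mapsTo_inv hz), f.right_inv z hz]
  smooth := f.smooth.comp g.smooth g.mapsTo
  smooth_inv := g.smooth_inv.comp f.smooth_inv f.mapsTo_inv
  area := by
    intro z hz u v
    have h1 : DifferentiableWithinAt ℝ g.toFun disc z :=
      (g.smooth.differentiableOn (by simp)) z hz
    have h2 : DifferentiableWithinAt ℝ f.toFun disc (g.toFun z) :=
      (f.smooth.differentiableOn (by simp)) _ (g.mapsTo hz)
    rw [fderivWithin_comp z h2 h1 g.mapsTo (uniqueDiffOn_disc z hz)]
    simp only [ContinuousLinearMap.comp_apply]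
    rw [f.area _ (g.mapsTo hz), g.area z hz]

end AreaDiffeo

/-! ## One-forms -/

section Forms

variable {E F : Type*} [NormedAddCommGroup E] [NormedSpace ℝ E]
  [NormedAddCommGroup F] [NormedSpace ℝ F]

/-- The exterior derivative `dA(u, v)` at `x` of a one-form `A` on `S ⊆ E` (`S` is open, or the
closure of an open convex set). -/
def extd (S : Set E) (A : E → E →L[ℝ] ℝ) (x u v : E) : ℝ :=
  fderivWithin ℝ A S x u v - fderivWithin ℝ A S x v u

/-- The three-form `A ∧ dA` on `S`. -/
def contactVol (S : Set E) (A : E → E →L[ℝ] ℝ) (x u v w : E) : ℝ :=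
  A x u * extd S A x v w + A x v * extd S A x w u + A x w * extd S A x u v

/-- The pull-back `f^* A` of a one-form. -/
def pull (f : E → F) (A : F → F →L[ℝ] ℝ) (x : E) : E →L[ℝ] ℝ :=
  (A (f x)).comp (fderiv ℝ f x)

end Forms

/-! ## Hamiltonians and contact forms on the solid torus

`S¹ = ℝ/2πℤ`; objects on `S¹ × D²` are `2π`-periodic objects on `ℝ × D²`. -/

/-- The universal cover `ℝ × D²` of the solid torus `V = S¹ × D²`. -/
def solidTorus : Set (ℝ × ℂ) := univ ×ˢ disc

/-- A smooth, `2π`-periodic, time-dependent Hamiltonian function on the disc. -/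
structure IsPeriodicHamiltonian (H : ℝ → ℂ → ℝ) : Prop where
  smooth : ContDiffOn ℝ ∞ (fun p : ℝ × ℂ => H p.1 p.2) solidTorus
  periodic : ∀ s, ∀ z ∈ disc, H (s + 2 * Real.pi) z = H s z

/-- `ψ` is the time-`2π` map of the Hamiltonian isotopy of the disc generated by `H`, where the
Hamiltonian vector field `X_s` is given by `ω(X_s, ·) = dH_s`. -/
def Generates (H : ℝ → ℂ → ℝ) (ψ : AreaDiffeo) : Prop :=
  ∃ F : ℝ → AreaDiffeo,
    ContDiffOn ℝ ∞ (fun p : ℝ × ℂ => F p.1 p.2) solidTorus ∧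
    (∀ z ∈ disc, F 0 z = z) ∧
    (∀ z ∈ disc, F (2 * Real.pi) z = ψ z) ∧
    ∀ s, ∀ z ∈ disc, ∃ X : ℂ, HasDerivAt (fun t => F t z) X s ∧
      ∀ v : ℂ, omega X v = fderivWithin ℝ (H s) disc (F s z) v

/-- The standard primitive `λ = r² dθ = x dy - y dx` of `ω`. -/
def stdPrimitive (z : ℂ) : ℂ →L[ℝ] ℝ := z.re • Complex.imCLM - z.im • Complex.reCLM

/-- `l` is a smooth primitive of the area form on the disc. -/
structure IsPrimitive (l : ℂ → ℂ →L[ℝ] ℝ) : Prop where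
  smooth : ContDiffOn ℝ ∞ l disc
  primitive : ∀ z ∈ disc, ∀ u v : ℂ, extd disc l z u v = omega u v

/-- The one-form `H_s ds + l` on the solid torus. -/
def hamForm (H : ℝ → ℂ → ℝ) (l : ℂ → ℂ →L[ℝ] ℝ) (p : ℝ × ℂ) : ℝ × ℂ →L[ℝ] ℝ :=
  H p.1 p.2 • ContinuousLinearMap.fst ℝ ℝ ℂ + (l p.2).comp (ContinuousLinearMap.snd ℝ ℝ ℂ)

/-- Positive contact forms on the solid torus, oriented by `ds ∧ ω`. -/
def IsPositiveContact (A : ℝ × ℂ → ℝ × ℂ →L[ℝ] ℝ) : Prop :=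
  ∀ p ∈ solidTorus, 0 < contactVol solidTorus A p (1, 0) (0, 1) (0, Complex.I)

/-! ## The cut construction -/

/-- Polar coordinates `(b, ρ, ϑ) ↦ (b, ρ e^{iϑ})` on `B × D²`, with `B = ℝ/2πℤ` the binding. -/
def polar (x : ℝ × ℝ × ℝ) : ℝ × ℂ :=
  (x.1, (x.2.1 : ℂ) * Complex.exp ((x.2.2 : ℂ) * Complex.I))

/-- The embedding `g⁻¹ ∘ Φ` of a pointed neighbourhood of the binding into the interior of the solid
torus, where `Φ(b; ρ, ϑ)` has the coordinates `s = ϑ`, `r = 1 - ρ²`, `θ = b - hϑ`, and where the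
diffeomorphism `g` of the disc acts on the second factor of `S¹ × D²`. -/
def bindingEmb (h : ℕ) (g : AreaDiffeo) (x : ℝ × ℝ × ℝ) : ℝ × ℂ :=
  (x.2.2, g.invFun
    (((1 - x.2.1 ^ 2 : ℝ) : ℂ) * Complex.exp (((x.1 - h * x.2.2 : ℝ) : ℂ) * Complex.I)))

/-- The pull-back of `A` under the embedding `g⁻¹ ∘ Φ` extends as a smooth contact form over the
binding `B × {0}`. -/
def ExtendsOverBinding (h : ℕ) (g : AreaDiffeo) (A : ℝ × ℂ → ℝ × ℂ →L[ℝ] ℝ) : Prop :=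
  ∃ δ : ℝ, 0 < δ ∧ δ ≤ 1 ∧ ∃ C : ℝ × ℂ → ℝ × ℂ →L[ℝ] ℝ,
    ContDiffOn ℝ ∞ C (univ ×ˢ Metric.ball 0 δ) ∧
    (∀ b w, C (b + 2 * Real.pi, w) = C (b, w)) ∧
    (∀ p ∈ univ ×ˢ Metric.ball (0 : ℂ) δ,
      contactVol (univ ×ˢ Metric.ball 0 δ) C p (1, 0) (0, 1) (0, Complex.I) ≠ 0) ∧
    ∀ b ρ ϑ : ℝ, 0 < ρ → ρ < δ →
      pull polar C (b, ρ, ϑ) = pull (bindingEmb h g) A (b, ρ, ϑ)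

/-- The disc map `ψ` embeds into a Reeb flow by the cut construction, starting from the contact form
`H_s ds + l` on `S¹ × D²`: the map `ψ` is generated by the Hamiltonian `H_s`, which equals `h` along
the boundary, and the contact form descends to the manifold that is obtained by collapsing the
orbits of the circle action on `∂(S¹ × D²)` generated by `g^* Y`, where `Y = ∂_s - h ∂_θ`. -/
structure EmbedsByCut (h : ℕ) (H : ℝ → ℂ → ℝ) (l : ℂ → ℂ →L[ℝ] ℝ) (g ψ : AreaDiffeo) : Prop where
  hamiltonian : IsPeriodicHamiltonian H
  boundary : ∀ s, ∀ z ∈ circ, H s z = h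
  generates : Generates H ψ
  primitive : IsPrimitive l
  contact : IsPositiveContact (hamForm H l)
  extends_over : ExtendsOverBinding h g (hamForm H l)

/-! ## Reeb flows on the three-sphere -/

/-- The unit sphere `S³` in `ℂ² = ℝ⁴`. -/
def sphere3 : Set (ℂ × ℂ) := {p | ‖p.1‖ ^ 2 + ‖p.2‖ ^ 2 = 1}

/-- `u` is tangent to `S³` at `p ∈ S³`. -/
def IsTangent (p u : ℂ × ℂ) : Prop :=
  p.1.re * u.1.re + p.1.im * u.1.im + p.2.re * u.2.re + p.2.im * u.2.im = 0

/-- Contact forms on `S³`. A smooth one-form on `S³` is the restriction to `TS³` of a smooth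
one-form on `ℂ² ∖ {0}`. -/
structure IsContactFormS3 (A : ℂ × ℂ → ℂ × ℂ →L[ℝ] ℝ) : Prop where
  smooth : ContDiffOn ℝ ∞ A {0}ᶜ
  contact : ∀ p ∈ sphere3, ∀ u v w, IsTangent p u → IsTangent p v → IsTangent p w →
    LinearIndependent ℝ ![u, v, w] → contactVol {0}ᶜ A p u v w ≠ 0

/-- `R` is (on `S³`) the Reeb vector field of `A|_{TS³}`. -/
def IsReebField (A : ℂ × ℂ → ℂ × ℂ →L[ℝ] ℝ) (R : ℂ × ℂ → ℂ × ℂ) : Prop :=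
  ∀ p ∈ sphere3, IsTangent p (R p) ∧ A p (R p) = 1 ∧
    ∀ v, IsTangent p v → extd {0}ᶜ A p (R p) v = 0

/-- `Fl` is the flow on `S³` of the vector field `R`. -/
def IsFlowOf (R : ℂ × ℂ → ℂ × ℂ) (Fl : ℝ → ℂ × ℂ → ℂ × ℂ) : Prop :=
  ∀ p ∈ sphere3, Fl 0 p = p ∧
    ∀ t, Fl t p ∈ sphere3 ∧ HasDerivAt (fun τ => Fl τ p) (R (Fl t p)) t

/-- `j` parametrises a smoothly embedded closed disc in `S³`: the map `j` is a topological embedding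
of the closed disc, a smooth immersion on the interior, and its image is the image of a smooth
embedding `e` of the closed disc. -/
def IsDiscParam (j : ℂ → ℂ × ℂ) : Prop :=
  ContinuousOn j disc ∧ InjOn j disc ∧ MapsTo j disc sphere3 ∧
  ContDiffOn ℝ ∞ j openDisc ∧ (∀ z ∈ openDisc, Function.Injective (fderiv ℝ j z)) ∧
  ∃ e : ℂ → ℂ × ℂ, ContDiffOn ℝ ∞ e disc ∧ InjOn e disc ∧
    (∀ z ∈ disc, Function.Injective (fderivWithin ℝ e disc z)) ∧
    e '' disc = j '' disc ∧ e '' circ = j '' circ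

/-- `j(D²)` is a global surface of section for the flow `Fl` of `R`. -/
structure IsGlobalSection (R : ℂ × ℂ → ℂ × ℂ) (Fl : ℝ → ℂ × ℂ → ℂ × ℂ) (j : ℂ → ℂ × ℂ) :
    Prop where
  disc_param : IsDiscParam j
  boundary_orbit : ∃ p ∈ sphere3, ∃ T > 0, Fl T p = p ∧ range (fun t => Fl t p) = j '' circ
  transverse : ∀ z ∈ openDisc, R (j z) ∉ range (fderiv ℝ j z)
  forward : ∀ p ∈ sphere3 \ j '' circ, ∃ t > 0, Fl t p ∈ j '' openDisc
  backward : ∀ p ∈ sphere3 \ j '' circ, ∃ t < 0, Fl t p ∈ j '' openDisc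

/-- In the parametrisation `j`, the map `ψ` is on the interior of the disc the Poincaré return map
(first return in forward time) of the flow `Fl`. -/
def IsReturnMap (Fl : ℝ → ℂ × ℂ → ℂ × ℂ) (j : ℂ → ℂ × ℂ) (ψ : ℂ → ℂ) : Prop :=
  ∀ z ∈ openDisc, ψ z ∈ openDisc ∧ ∃ t > 0, Fl t (j z) = j (ψ z) ∧
    ∀ t', 0 < t' → t' < t → Fl t' (j z) ∉ j '' openDisc

/-- `ψ` is the return map, in the parametrisation `j`, on a global surface of section for the Reeb
flow on `S³` of the contact form `A`. -/
def RealisedBy (A : ℂ × ℂ → ℂ × ℂ →L[ℝ] ℝ) (j : ℂ → ℂ × ℂ) (ψ : AreaDiffeo) : Prop :=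
  IsContactFormS3 A ∧ ∃ R Fl, IsReebField A R ∧ IsFlowOf R Fl ∧
    IsGlobalSection R Fl j ∧ IsReturnMap Fl j ψ

/-- `ψ` embeds into a Reeb flow on `S³`. -/
def EmbedsIntoReebFlow (ψ : AreaDiffeo) : Prop :=
  ∃ A j, RealisedBy A j ψ

/-- The map `q : S¹ × D² → S³` exhibits `S³` with the contact form `A` as the contact cut of
`(S¹ × D², β)`, for the circle action on `∂(S¹ × D²)` generated by `g^* Y`, `Y = ∂_s - h ∂_θ`, and
the embedding `g⁻¹ ∘ Φ` of a pointed neighbourhood of the binding. -/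
structure IsContactCut (h : ℕ) (g : AreaDiffeo) (β : ℝ × ℂ → ℝ × ℂ →L[ℝ] ℝ)
    (A : ℂ × ℂ → ℂ × ℂ →L[ℝ] ℝ) (q : ℝ × ℂ → ℂ × ℂ) : Prop where
  continuousOn : ContinuousOn q solidTorus
  surj : q '' solidTorus = sphere3
  /-- The fibres of `q` are the points of `S¹ × Int D²` and the orbits in `S¹ × ∂D²`. -/
  fibres : ∀ s s' : ℝ, ∀ z ∈ disc, ∀ z' ∈ disc, (q (s, z) = q (s', z') ↔
    (z = z' ∧ ∃ n : ℤ, s' = s + n * (2 * Real.pi)) ∨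
    (z ∈ circ ∧ z' ∈ circ ∧
      g z' = Complex.exp (((-(h * (s' - s)) : ℝ) : ℂ) * Complex.I) * g z))
  smooth : ContDiffOn ℝ ∞ q (univ ×ˢ openDisc)
  immersion : ∀ p ∈ univ ×ˢ openDisc, Function.Injective (fderiv ℝ q p)
  form : ∀ p ∈ univ ×ˢ openDisc, pull q A p = β p
  /-- Near the binding, `q ∘ g⁻¹ ∘ Φ` extends to a smooth immersion of `B × D²_δ`. -/
  binding : ∃ δ : ℝ, 0 < δ ∧ δ ≤ 1 ∧ ∃ N : ℝ × ℂ → ℂ × ℂ,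
    ContDiffOn ℝ ∞ N (univ ×ˢ Metric.ball 0 δ) ∧
    (∀ p ∈ univ ×ˢ Metric.ball (0 : ℂ) δ, Function.Injective (fderiv ℝ N p)) ∧
    ∀ b ρ ϑ : ℝ, 0 < ρ → ρ < δ → N (polar (b, ρ, ϑ)) = q (bindingEmb h g (b, ρ, ϑ))

end ReebCut

end

/-!
Conjugation by `φ` is a change of coordinates. Pulling `H_s ds + λ` back by `id × φ` gives the form
`K_s ds + φ^*λ` with `K_s = H_s ∘ φ`, which generates `φ⁻¹ ∘ ψ ∘ φ`, since a conjugated Hamiltonian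
isotopy is generated by the pulled-back Hamiltonian; and `φ⁻¹ ∘ Φ` pulls it back to the same form
near the binding as `Φ` does `H_s ds + λ`. So the cut construction applies with `g = φ`
(`EmbedsByCut.conj`), and a contact cut for `ψ` becomes one for the conjugate after precomposition
of the quotient map with `id × φ`. The same contact form on `S³`, the same page and the same flow
serve for both maps: only the parametrisation of the page changes.

It remains to realise the cut for `ψ`. The quotient map is explicit,
`cutMap h (s, z) = (√(1 - |z|²) e^{is}, e^{ihs} z)`, and in polar coordinates around the binding
`{0} × S¹` it becomes `bindMap (b, w) = (√(2 - |w|²) w, (1 - |w|²) e^{ib})`, which is smooth across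
`w = 0` (`bindMap_polar`). Local inverses of the two maps, precomposed with the radial retraction
of `ℂ² ∖ {0}` onto `S³`, transport `H_s ds + λ` and its extension `C` over the binding to
`ℂ² ∖ {0}`; they agree where both are defined because both factor through polar coordinates
(`IsGluingPair.sphereForm_eq_bind`). Naturality of `d` makes the result a contact form on `S³`.

No general theory of flows is needed. Off the binding the kernel of `d(H_s ds + λ)` is spanned by
`∂_s + X_s` (`extd_hamForm_hamVec`), so the Reeb orbits are the curves `s ↦ (s, F_s(a))` of the
given Hamiltonian isotopy, traversed with speed `1 / (H_s + λ(X_s))`. Positivity of the contact form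
on the compact solid torus bounds `H_s + λ(X_s)` below by a positive constant, so integrating it
along an orbit gives a diffeomorphism of the line, whose inverse reparametrises the orbit for all
times. Along the binding `C = db`, and `∂_b` lies in the kernel of `dC` because
`C(∂_b) = (1 - |w|²)²` is critical at `w = 0`; so the Reeb flow is a rotation there. An orbit off
the binding meets the page `s = 0` exactly at the times at which `s` is a multiple of `2π`, and
after one turn `F_{2π} = ψ` is the return map (`realisedBy_page`).
The page is the hemisphere `{(√(1 - |z|²), z)}`. This parametrisation is not smooth at the
boundary, but stereographic projection gives one that is (`hemisphere`).
-/

noncomputable section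

namespace ReebCut

open Filter Topology

/-! ### Exterior derivatives and pull-backs of one-forms -/

section Calculus

variable {E F G : Type*} [NormedAddCommGroup E] [NormedSpace ℝ E]
  [NormedAddCommGroup F] [NormedSpace ℝ F] [NormedAddCommGroup G] [NormedSpace ℝ G]

/-- Naturality of the exterior derivative: `d(f^* A) = f^*(dA)`, for derivatives within sets. -/
theorem extd_pullWithin {S : Set E} {T : Set F} {f : E → F} {A : F → F →L[ℝ] ℝ} {x : E}
    (hS : UniqueDiffOn ℝ S) (hx : x ∈ S) (hxc : x ∈ closure (interior S))
    (hf : ContDiffWithinAt ℝ ∞ f S x) (hST : MapsTo f S T)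
    (hA : DifferentiableWithinAt ℝ A T (f x)) (u v : E) :
    extd S (fun y => (A (f y)).comp (fderivWithin ℝ f S y)) x u v =
      extd T A (f x) (fderivWithin ℝ f S x u) (fderivWithin ℝ f S x v) := by
  have hd : DifferentiableWithinAt ℝ f S x := hf.differentiableWithinAt (by simp)
  have hd2 : DifferentiableWithinAt ℝ (fderivWithin ℝ f S) S x :=
    (hf.fderivWithin_right (m := ∞) hS (by simp) hx).differentiableWithinAt
      (by simp)
  have hsymm : IsSymmSndFDerivWithinAt ℝ f S x :=
    (hf.of_le (m := 2) (WithTop.coe_le_coe.2 le_top)).isSymmSndFDerivWithinAt (by simp) hS hxc hx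
  have hAf : DifferentiableWithinAt ℝ (fun y => A (f y)) S x := hA.comp x hd hST
  have h1 := fderivWithin_clm_comp (hS x hx) hAf hd2
  have h2 : fderivWithin ℝ (fun y => A (f y)) S x =
      (fderivWithin ℝ A T (f x)).comp (fderivWithin ℝ f S x) :=
    fderivWithin_comp x hA hd hST (hS x hx)
  unfold extd
  rw [h1, h2]
  simp [hsymm u v]

/-- On a neighbourhood of a point the exterior derivative within a set is the unrestricted one. -/
theorem extd_of_mem_nhds {S : Set E} {A : E → E →L[ℝ] ℝ} {x : E} (hS : S ∈ 𝓝 x) :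
    extd S A x = extd univ A x := by
  funext u v
  simp [extd, fderivWithin_of_mem_nhds hS]

theorem contactVol_of_mem_nhds {S : Set E} {A : E → E →L[ℝ] ℝ} {x : E} (hS : S ∈ 𝓝 x) :
    contactVol S A x = contactVol univ A x := by
  funext u v w
  simp [contactVol, extd_of_mem_nhds hS]

theorem extd_congr_of_eventuallyEq {A B : E → E →L[ℝ] ℝ} {x : E} (h : A =ᶠ[𝓝 x] B) :
    extd univ A x = extd univ B x := by
  funext u v
  simp [extd, fderivWithin_univ, h.fderiv_eq]

theorem contactVol_congr_of_eventuallyEq {A B : E → E →L[ℝ] ℝ} {x : E} (h : A =ᶠ[𝓝 x] B) :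
    contactVol univ A x = contactVol univ B x := by
  funext u v w
  simp [contactVol, extd_congr_of_eventuallyEq h, h.eq_of_nhds]

theorem extd_congr_set {S : Set E} {A B : E → E →L[ℝ] ℝ} {x : E} (h : EqOn A B S) (hx : x ∈ S) :
    extd S A x = extd S B x := by
  funext u v
  simp [extd, fderivWithin_congr h (h hx)]

theorem contactVol_congr_set {S : Set E} {A B : E → E →L[ℝ] ℝ} {x : E} (h : EqOn A B S)
    (hx : x ∈ S) : contactVol S A x = contactVol S B x := by
  funext u v w
  simp [contactVol, extd_congr_set h hx, h hx]

theorem extd_pull {f : E → F} {A : F → F →L[ℝ] ℝ} {x : E} (hf : ContDiffAt ℝ ∞ f x)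
    (hA : DifferentiableAt ℝ A (f x)) (u v : E) :
    extd univ (pull f A) x u v = extd univ A (f x) (fderiv ℝ f x u) (fderiv ℝ f x v) := by
  have := extd_pullWithin uniqueDiffOn_univ (mem_univ x) (by simp) hf.contDiffWithinAt
    (mapsTo_univ f univ) (A := A) hA.differentiableWithinAt u v
  simp only [fderivWithin_univ] at this
  exact this

theorem contactVol_pull {f : E → F} {A : F → F →L[ℝ] ℝ} {x : E} (hf : ContDiffAt ℝ ∞ f x)
    (hA : DifferentiableAt ℝ A (f x)) (u v w : E) :
    contactVol univ (pull f A) x u v w =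
      contactVol univ A (f x) (fderiv ℝ f x u) (fderiv ℝ f x v) (fderiv ℝ f x w) := by
  simp [contactVol, extd_pull hf hA, pull]

theorem contDiffAt_pull {f : E → F} {A : F → F →L[ℝ] ℝ} {x : E} (hf : ContDiffAt ℝ ∞ f x)
    (hA : ContDiffAt ℝ ∞ A (f x)) : ContDiffAt ℝ ∞ (pull f A) x :=
  (hA.comp x hf).clm_comp (hf.fderiv_right (by simp))

theorem pull_comp {f : E → F} {g : F → G} {A : G → G →L[ℝ] ℝ} {x : E}
    (hf : DifferentiableAt ℝ f x) (hg : DifferentiableAt ℝ g (f x)) :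
    pull (fun y => g (f y)) A x = pull f (pull g A) x := by
  unfold pull
  rw [show (fun y => g (f y)) = g ∘ f from rfl, fderiv_comp x hg hf]
  rfl

theorem pull_congr_of_eventuallyEq {f g : E → F} {A : F → F →L[ℝ] ℝ} {x : E} (h : f =ᶠ[𝓝 x] g) :
    pull f A x = pull g A x := by
  unfold pull
  rw [h.eq_of_nhds, h.fderiv_eq]

/-- The pull-backs under two maps that differ by a period of the form coincide. -/
theorem pull_congr_of_eventuallyEq_add {f g : E → F} {A : F → F →L[ℝ] ℝ} {x : E} {v : F}
    (h : f =ᶠ[𝓝 x] fun y => g y + v) (hA : A (g x + v) = A (g x)) : pull f A x = pull g A x := by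
  unfold pull
  rw [h.eq_of_nhds, h.fderiv_eq, fderiv_add_const, hA]

theorem fderiv_comp_apply_of_leftInverse {f : E → F} {g : F → E} {x : E}
    (hf : DifferentiableAt ℝ f x) (hg : DifferentiableAt ℝ g (f x))
    (h : ∀ᶠ y in 𝓝 x, g (f y) = y) (v : E) : fderiv ℝ g (f x) (fderiv ℝ f x v) = v := by
  have h1 : fderiv ℝ (g ∘ f) x = ContinuousLinearMap.id ℝ E := by
    have : (g ∘ f) =ᶠ[𝓝 x] id := h
    rw [this.fderiv_eq, fderiv_id]
  rw [fderiv_comp x hg hf] at h1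
  exact congrArg (fun L : E →L[ℝ] E => L v) h1

theorem fderiv_injective_of_leftInverse {f : E → F} {g : F → E} {x : E}
    (hf : DifferentiableAt ℝ f x) (hg : DifferentiableAt ℝ g (f x))
    (h : ∀ᶠ y in 𝓝 x, g (f y) = y) : Function.Injective (fderiv ℝ f x) :=
  Function.LeftInverse.injective (fderiv_comp_apply_of_leftInverse hf hg h)

end Calculus

/-! ### Volume forms on `ℝ × ℂ` -/

/-- The determinant of three vectors of `ℝ × ℂ = ℝ³`. -/
def det3 (u v w : ℝ × ℂ) : ℝ :=
  u.1 * (v.2.re * w.2.im - v.2.im * w.2.re) - v.1 * (u.2.re * w.2.im - u.2.im * w.2.re) +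
    w.1 * (u.2.re * v.2.im - u.2.im * v.2.re)

theorem contactVol_eq_det3_mul (S : Set (ℝ × ℂ)) (A : ℝ × ℂ → ℝ × ℂ →L[ℝ] ℝ) (x u v w : ℝ × ℂ) :
    contactVol S A x u v w =
      det3 u v w * contactVol S A x (1, 0) (0, 1) (0, Complex.I) := by
  have hdec : ∀ u : ℝ × ℂ, u = u.1 • ((1, 0) : ℝ × ℂ) + u.2.re • ((0, 1) : ℝ × ℂ)
      + u.2.im • ((0, Complex.I) : ℝ × ℂ) := by
    intro u
    ext <;> simp
  unfold contactVol extd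
  generalize fderivWithin ℝ A S x = D
  generalize A x = a
  have ha : ∀ u : ℝ × ℂ, a u = u.1 * a (1, 0) + u.2.re * a (0, 1) + u.2.im * a (0, Complex.I) := by
    intro u
    conv_lhs => rw [hdec u]
    simp only [map_add, map_smul, smul_eq_mul]
  have hD : ∀ u v : ℝ × ℂ, D u v =
      u.1 * (v.1 * D (1, 0) (1, 0) + v.2.re * D (1, 0) (0, 1) + v.2.im * D (1, 0) (0, Complex.I))
      + u.2.re * (v.1 * D (0, 1) (1, 0) + v.2.re * D (0, 1) (0, 1)
        + v.2.im * D (0, 1) (0, Complex.I))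
      + u.2.im * (v.1 * D (0, Complex.I) (1, 0) + v.2.re * D (0, Complex.I) (0, 1)
        + v.2.im * D (0, Complex.I) (0, Complex.I)) := by
    intro u v
    conv_lhs => rw [hdec u, hdec v]
    simp only [map_add, map_smul, smul_eq_mul, add_apply, smul_apply]
    ring
  rw [ha u, ha v, ha w, hD u v, hD v u, hD v w, hD w v, hD u w, hD w u, det3]
  ring

theorem det3_ne_zero {u v w : ℝ × ℂ} (h : LinearIndependent ℝ ![u, v, w]) : det3 u v w ≠ 0 := by
  let e : ℝ × ℂ →ₗ[ℝ] (Fin 3 → ℝ) :=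
    { toFun := fun p => ![p.1, p.2.re, p.2.im]
      map_add' := by intro p q; ext i; fin_cases i <;> simp
      map_smul' := by intro c p; ext i; fin_cases i <;> simp }
  have he : LinearMap.ker e = ⊥ := by
    rw [LinearMap.ker_eq_bot]
    intro p q hpq
    have h0 := congrFun hpq 0
    have h1 := congrFun hpq 1
    have h2 := congrFun hpq 2
    simp [e] at h0 h1 h2
    exact Prod.ext h0 (Complex.ext h1 h2)
  have h3 := h.map' e he
  have hM := (Matrix.linearIndependent_rows_iff_isUnit
    (A := Matrix.of (fun i => e (![u, v, w] i)))).1 h3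
  rw [Matrix.isUnit_iff_isUnit_det, isUnit_iff_ne_zero, Matrix.det_fin_three] at hM
  intro h0
  apply hM
  simp [e]
  rw [det3] at h0
  linarith

/-! ### Maps of the disc -/

theorem mem_disc {z : ℂ} : z ∈ disc ↔ ‖z‖ ≤ 1 := by simp [disc]

theorem mem_openDisc {z : ℂ} : z ∈ openDisc ↔ ‖z‖ < 1 := by simp [openDisc]

theorem mem_circ {z : ℂ} : z ∈ circ ↔ ‖z‖ = 1 := by simp [circ]

theorem openDisc_subset_disc : openDisc ⊆ disc := Metric.ball_subset_closedBall

theorem circ_subset_disc : circ ⊆ disc := Metric.sphere_subset_closedBall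

theorem isOpen_openDisc : IsOpen openDisc := Metric.isOpen_ball

theorem disc_mem_nhds {z : ℂ} (hz : z ∈ openDisc) : disc ∈ 𝓝 z :=
  mem_of_superset (isOpen_openDisc.mem_nhds hz) openDisc_subset_disc

theorem mem_circ_iff {z : ℂ} (hz : z ∈ disc) : z ∈ circ ↔ z ∉ openDisc := by
  rw [mem_circ, mem_openDisc, not_lt]
  exact ⟨fun h => h.ge, fun h => le_antisymm (mem_disc.1 hz) h⟩

theorem interior_disc : interior disc = openDisc := interior_closedBall _ one_ne_zero

theorem disc_subset_closure_interior : disc ⊆ closure (interior disc) := by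
  rw [interior_disc, openDisc, closure_ball _ one_ne_zero]
  exact subset_rfl

theorem omega_eq_zero {X : ℂ} (h : ∀ v, omega X v = 0) : X = 0 := by
  have h1 := h 1
  have h2 := h Complex.I
  simp [omega] at h1 h2
  exact Complex.ext h2 h1

namespace AreaDiffeo

variable (f : AreaDiffeo)

theorem differentiableWithinAt {z : ℂ} (hz : z ∈ disc) :
    DifferentiableWithinAt ℝ f.toFun disc z :=
  f.smooth.differentiableOn (by simp) z hz

theorem fderivWithin_injective {z : ℂ} (hz : z ∈ disc) :
    Function.Injective (fderivWithin ℝ f.toFun disc z) := by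
  rw [injective_iff_map_eq_zero]
  intro u hu
  refine omega_eq_zero fun v => ?_
  rw [← f.area z hz u v, hu]
  simp [omega]

/-- Invariance of domain for the disc: interior points go to interior points, by the inverse
function theorem. -/
theorem mapsTo_openDisc : MapsTo f openDisc openDisc := by
  intro z hz
  have hc : ContDiffAt ℝ ∞ f.toFun z :=
    (f.smooth z (openDisc_subset_disc hz)).contDiffAt (disc_mem_nhds hz)
  have hinj : Function.Injective (fderiv ℝ f.toFun z) := by
    have := f.fderivWithin_injective (openDisc_subset_disc hz)
    rwa [fderivWithin_of_mem_nhds (disc_mem_nhds hz)] at this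
  have hs : HasStrictFDerivAt f.toFun (fderiv ℝ f.toFun z) z :=
    hc.hasStrictFDerivAt (by simp)
  have hsurj : (fderiv ℝ f.toFun z).range = ⊤ := by
    have := LinearMap.injective_iff_surjective (f := (fderiv ℝ f.toFun z : ℂ →ₗ[ℝ] ℂ))
    exact LinearMap.range_eq_top.2 (this.1 hinj)
  have hmap := hs.map_nhds_eq_of_surj hsurj
  have : disc ∈ 𝓝 (f z) := by
    rw [← hmap]
    exact mem_map.2 (mem_of_superset (disc_mem_nhds hz) fun w hw => f.mapsTo hw)
  rwa [← interior_disc, mem_interior_iff_mem_nhds]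

theorem mapsTo_inv_openDisc : MapsTo f.invFun openDisc openDisc := f.symm.mapsTo_openDisc

theorem mem_openDisc_iff {z : ℂ} (hz : z ∈ disc) : f z ∈ openDisc ↔ z ∈ openDisc :=
  ⟨fun h => by simpa [f.left_inv z hz] using f.mapsTo_inv_openDisc h, fun h => f.mapsTo_openDisc h⟩

theorem mem_circ_iff {z : ℂ} (hz : z ∈ disc) : f z ∈ circ ↔ z ∈ circ := by
  rw [ReebCut.mem_circ_iff hz, ReebCut.mem_circ_iff (f.mapsTo hz), f.mem_openDisc_iff hz]

theorem injOn : InjOn f disc := fun z hz w hw h => by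
  rw [← f.left_inv z hz, ← f.left_inv w hw, h]

theorem image_disc : f '' disc = disc :=
  Subset.antisymm (image_subset_iff.2 f.mapsTo) fun z hz => ⟨_, f.mapsTo_inv hz, f.right_inv z hz⟩

theorem image_circ : f '' circ = circ := by
  refine Subset.antisymm ?_ ?_
  · rintro _ ⟨z, hz, rfl⟩
    exact (f.mem_circ_iff (circ_subset_disc hz)).2 hz
  · intro z hz
    refine ⟨_, ?_, f.right_inv z (circ_subset_disc hz)⟩
    exact (f.symm.mem_circ_iff (circ_subset_disc hz)).2 hz

theorem image_openDisc : f '' openDisc = openDisc :=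
  Subset.antisymm (image_subset_iff.2 f.mapsTo_openDisc) fun z hz =>
    ⟨_, f.mapsTo_inv_openDisc hz, f.right_inv z (openDisc_subset_disc hz)⟩

theorem contDiffAt {z : ℂ} (hz : z ∈ openDisc) : ContDiffAt ℝ ∞ f.toFun z :=
  (f.smooth z (openDisc_subset_disc hz)).contDiffAt (disc_mem_nhds hz)

theorem fderiv_injective {z : ℂ} (hz : z ∈ openDisc) : Function.Injective (fderiv ℝ f.toFun z) := by
  have := f.fderivWithin_injective (openDisc_subset_disc hz)
  rwa [fderivWithin_of_mem_nhds (disc_mem_nhds hz)] at this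

end AreaDiffeo

/-! ### Conjugation of the cut construction by a disc map -/

/-- The interior `ℝ × Int D²` of the universal cover of the solid torus. -/
def openTorus : Set (ℝ × ℂ) := univ ×ˢ openDisc

theorem isOpen_openTorus : IsOpen openTorus := isOpen_univ.prod isOpen_openDisc

theorem openTorus_subset_solidTorus : openTorus ⊆ solidTorus :=
  prod_mono subset_rfl openDisc_subset_disc

theorem solidTorus_mem_nhds {p : ℝ × ℂ} (hp : p.2 ∈ openDisc) : solidTorus ∈ 𝓝 p :=
  mem_of_superset (isOpen_openTorus.mem_nhds ⟨mem_univ _, hp⟩) openTorus_subset_solidTorus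

theorem uniqueDiffOn_solidTorus : UniqueDiffOn ℝ solidTorus :=
  uniqueDiffOn_univ.prod uniqueDiffOn_disc

theorem solidTorus_subset_closure_interior : solidTorus ⊆ closure (interior solidTorus) := by
  rw [solidTorus, interior_prod_eq, closure_prod_eq, interior_univ, closure_univ]
  exact prod_mono subset_rfl disc_subset_closure_interior

/-- The pull-back `f^* l` of a one-form on the disc. -/
def AreaDiffeo.pullForm (f : AreaDiffeo) (l : ℂ → ℂ →L[ℝ] ℝ) (z : ℂ) : ℂ →L[ℝ] ℝ :=
  (l (f z)).comp (fderivWithin ℝ f.toFun disc z)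

/-- The diffeomorphism `id × f` of the solid torus. -/
def AreaDiffeo.torusMap (f : AreaDiffeo) (p : ℝ × ℂ) : ℝ × ℂ := (p.1, f p.2)

/-- The conjugate `f⁻¹ ∘ ψ ∘ f`. -/
def AreaDiffeo.conj (f ψ : AreaDiffeo) : AreaDiffeo := f.symm.comp (ψ.comp f)

namespace AreaDiffeo

variable (f : AreaDiffeo)

theorem contDiffOn_torusMap : ContDiffOn ℝ ∞ f.torusMap solidTorus :=
  contDiffOn_fst.prodMk (f.smooth.comp contDiffOn_snd fun _ hp => hp.2)

theorem mapsTo_torusMap : MapsTo f.torusMap solidTorus solidTorus :=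
  fun _ hp => ⟨mem_univ _, f.mapsTo hp.2⟩

theorem fderivWithin_torusMap {p : ℝ × ℂ} (hp : p ∈ solidTorus) (u : ℝ × ℂ) :
    fderivWithin ℝ f.torusMap solidTorus p u = (u.1, fderivWithin ℝ f.toFun disc p.2 u.2) := by
  have h2 : HasFDerivWithinAt (fun q : ℝ × ℂ => f.toFun q.2)
      ((fderivWithin ℝ f.toFun disc p.2).comp (ContinuousLinearMap.snd ℝ ℝ ℂ)) solidTorus p :=
    (f.differentiableWithinAt hp.2).hasFDerivWithinAt.comp p hasFDerivWithinAt_snd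
      (fun _ hq => hq.2)
  have := (hasFDerivWithinAt_fst.prodMk h2).fderivWithin (uniqueDiffOn_solidTorus p hp)
  unfold torusMap
  rw [this]
  rfl

theorem hamForm_pullForm (H : ℝ → ℂ → ℝ) (l : ℂ → ℂ →L[ℝ] ℝ) {p : ℝ × ℂ} (hp : p ∈ solidTorus) :
    hamForm (fun s z => H s (f z)) (f.pullForm l) p =
      (hamForm H l (f.torusMap p)).comp (fderivWithin ℝ f.torusMap solidTorus p) := by
  apply ContinuousLinearMap.ext
  intro u
  rw [ContinuousLinearMap.comp_apply, f.fderivWithin_torusMap hp]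
  simp [hamForm, pullForm, torusMap]

theorem hamForm_pullForm_eq_pull (H : ℝ → ℂ → ℝ) (l : ℂ → ℂ →L[ℝ] ℝ) {p : ℝ × ℂ}
    (hp : p ∈ openTorus) :
    hamForm (fun s z => H s (f z)) (f.pullForm l) p = pull f.torusMap (hamForm H l) p := by
  rw [f.hamForm_pullForm H l (openTorus_subset_solidTorus hp),
    fderivWithin_of_mem_nhds (solidTorus_mem_nhds hp.2)]
  rfl

theorem contDiffAt_torusMap {p : ℝ × ℂ} (hp : p.2 ∈ openDisc) : ContDiffAt ℝ ∞ f.torusMap p :=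
  (f.contDiffOn_torusMap p ⟨mem_univ _, openDisc_subset_disc hp⟩).contDiffAt
    (solidTorus_mem_nhds hp)

theorem fderivWithin_symm_apply {z : ℂ} (hz : z ∈ disc) (u : ℂ) :
    fderivWithin ℝ f.toFun disc (f.invFun z) (fderivWithin ℝ f.invFun disc z u) = u := by
  have hU := uniqueDiffOn_disc z hz
  have hc := fderivWithin_comp z (f.differentiableWithinAt (f.mapsTo_inv hz))
    (f.symm.differentiableWithinAt hz) f.mapsTo_inv hU
  have hid : fderivWithin ℝ (f.toFun ∘ f.invFun) disc z = ContinuousLinearMap.id ℝ ℂ :=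
    (fderivWithin_congr (f := id) (fun x hx => f.right_inv x hx) (f.right_inv z hz)).trans
      (fderivWithin_id hU)
  rw [hid] at hc
  exact (congrArg (fun L : ℂ →L[ℝ] ℂ => L u) hc).symm

end AreaDiffeo

theorem contDiffOn_hamForm {H : ℝ → ℂ → ℝ} {l : ℂ → ℂ →L[ℝ] ℝ} (hH : IsPeriodicHamiltonian H)
    (hl : ContDiffOn ℝ ∞ l disc) : ContDiffOn ℝ ∞ (hamForm H l) solidTorus :=
  (hH.smooth.smul contDiffOn_const).add
    ((hl.comp contDiffOn_snd fun _ hp => hp.2).clm_comp contDiffOn_const)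

theorem IsPeriodicHamiltonian.comp {H : ℝ → ℂ → ℝ} (hH : IsPeriodicHamiltonian H)
    (f : AreaDiffeo) : IsPeriodicHamiltonian (fun s z => H s (f z)) where
  smooth := hH.smooth.comp f.contDiffOn_torusMap f.mapsTo_torusMap
  periodic := fun s z hz => hH.periodic s (f z) (f.mapsTo hz)

theorem IsPeriodicHamiltonian.differentiableWithinAt {H : ℝ → ℂ → ℝ}
    (hH : IsPeriodicHamiltonian H) (s : ℝ) {z : ℂ} (hz : z ∈ disc) :
    DifferentiableWithinAt ℝ (H s) disc z := by
  have h1 : DifferentiableWithinAt ℝ (fun p : ℝ × ℂ => H p.1 p.2) solidTorus (s, z) :=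
    hH.smooth.differentiableOn (by simp) _ ⟨mem_univ _, hz⟩
  exact h1.comp (f := fun w : ℂ => (s, w)) z
    ((differentiableWithinAt_const s).prodMk differentiableWithinAt_id) fun w hw => ⟨mem_univ _, hw⟩

/-- If `H_s` generates `F_s`, then `H_s ∘ f` generates `f⁻¹ ∘ F_s ∘ f`. -/
theorem Generates.conj {H : ℝ → ℂ → ℝ} {ψ : AreaDiffeo} (hH : IsPeriodicHamiltonian H)
    (hψ : Generates H ψ) (f : AreaDiffeo) : Generates (fun s z => H s (f z)) (f.conj ψ) := by
  obtain ⟨F, hF, hF0, hF1, hX⟩ := hψ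
  refine ⟨fun s => f.conj (F s), ?_, ?_, ?_, ?_⟩
  · exact f.smooth_inv.comp (hF.comp f.contDiffOn_torusMap f.mapsTo_torusMap)
      fun p hp => (F p.1).mapsTo (f.mapsTo hp.2)
  · intro z hz
    change f.invFun (F 0 (f z)) = z
    rw [hF0 _ (f.mapsTo hz), f.left_inv z hz]
  · intro z hz
    change f.invFun (F _ (f z)) = f.invFun (ψ (f z))
    rw [hF1 _ (f.mapsTo hz)]
  · intro s z hz
    have hfz := f.mapsTo hz
    obtain ⟨X, hd, hom⟩ := hX s (f z) hfz
    have hw : F s (f z) ∈ disc := (F s).mapsTo hfz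
    have hw' := f.mapsTo_inv hw
    refine ⟨fderivWithin ℝ f.invFun disc (F s (f z)) X, ?_, ?_⟩
    · exact (f.symm.differentiableWithinAt hw).hasFDerivWithinAt.comp_hasDerivAt s hd
        (Eventually.of_forall fun t => (F t).mapsTo hfz)
    · intro v
      change _ = fderivWithin ℝ (H s ∘ f.toFun) disc (f.invFun (F s (f z))) v
      rw [fderivWithin_comp _ (t := disc)
        (by rw [f.right_inv _ hw]; exact hH.differentiableWithinAt s hw)
        (f.differentiableWithinAt hw') f.mapsTo (uniqueDiffOn_disc _ hw'), f.right_inv _ hw,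
        ContinuousLinearMap.comp_apply, ← hom, ← f.area _ hw', f.fderivWithin_symm_apply hw]

theorem IsPrimitive.pullForm {l : ℂ → ℂ →L[ℝ] ℝ} (hl : IsPrimitive l) (f : AreaDiffeo) :
    IsPrimitive (f.pullForm l) where
  smooth := (hl.smooth.comp f.smooth f.mapsTo).clm_comp
    (f.smooth.fderivWithin uniqueDiffOn_disc (by simp))
  primitive := by
    intro z hz u v
    have := extd_pullWithin uniqueDiffOn_disc hz (disc_subset_closure_interior hz) (f.smooth z hz)
      f.mapsTo (A := l) (hl.smooth.differentiableOn (by simp) _ (f.mapsTo hz)) u v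
    refine this.trans ?_
    rw [hl.primitive _ (f.mapsTo hz), f.area z hz]

theorem bindingEmb_comp (h : ℕ) (f g : AreaDiffeo) (x : ℝ × ℝ × ℝ) :
    bindingEmb h (g.comp f) x = f.symm.torusMap (bindingEmb h g x) := rfl

theorem ofReal_mul_exp_mem_openDisc {ρ a : ℝ} (h0 : 0 < ρ) (h1 : ρ < 1) :
    ((1 - ρ ^ 2 : ℝ) : ℂ) * Complex.exp ((a : ℂ) * Complex.I) ∈ openDisc := by
  rw [mem_openDisc, norm_mul, Complex.norm_exp_ofReal_mul_I, mul_one, Complex.norm_real,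
    Real.norm_eq_abs, abs_lt]
  constructor <;> nlinarith

theorem bindingEmb_mem_openTorus (h : ℕ) (g : AreaDiffeo) {x : ℝ × ℝ × ℝ} (h0 : 0 < x.2.1)
    (h1 : x.2.1 < 1) : bindingEmb h g x ∈ openTorus :=
  ⟨mem_univ _, g.mapsTo_inv_openDisc (ofReal_mul_exp_mem_openDisc h0 h1)⟩

theorem differentiableAt_bindingEmb (h : ℕ) (g : AreaDiffeo) {x : ℝ × ℝ × ℝ} (h0 : 0 < x.2.1)
    (h1 : x.2.1 < 1) : DifferentiableAt ℝ (bindingEmb h g) x := by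
  have hg : DifferentiableAt ℝ g.invFun (((1 - x.2.1 ^ 2 : ℝ) : ℂ) *
      Complex.exp (((x.1 - h * x.2.2 : ℝ) : ℂ) * Complex.I)) :=
    (g.symm.contDiffAt (ofReal_mul_exp_mem_openDisc h0 h1)).differentiableAt (by simp)
  have h2 : DifferentiableAt ℝ (fun x : ℝ × ℝ × ℝ => ((1 - x.2.1 ^ 2 : ℝ) : ℂ) *
      Complex.exp (((x.1 - h * x.2.2 : ℝ) : ℂ) * Complex.I)) x := by
    have e : ∀ r : ℝ, (r : ℂ) = Complex.ofRealCLM r := fun _ => rfl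
    simp only [e]
    fun_prop
  exact (by fun_prop : DifferentiableAt ℝ (fun x : ℝ × ℝ × ℝ => x.2.2) x).prodMk
    (DifferentiableAt.comp (g := g.invFun) x hg h2)

/-- The cut construction is natural: pulling everything back by `f` conjugates the disc map and
replaces `g` by `g ∘ f`. -/
theorem EmbedsByCut.conj {h : ℕ} {H : ℝ → ℂ → ℝ} {l : ℂ → ℂ →L[ℝ] ℝ} {g ψ : AreaDiffeo}
    (hψ : EmbedsByCut h H l g ψ) (f : AreaDiffeo) :
    EmbedsByCut h (fun s z => H s (f z)) (f.pullForm l) (g.comp f) (f.conj ψ) where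
  hamiltonian := hψ.hamiltonian.comp f
  boundary := fun s z hz => hψ.boundary s _ ((f.mem_circ_iff (circ_subset_disc hz)).2 hz)
  generates := hψ.generates.conj hψ.hamiltonian f
  primitive := hψ.primitive.pullForm f
  contact := by
    intro p hp
    have hfp := f.mapsTo_torusMap hp
    rw [contactVol_congr_set (fun q hq => f.hamForm_pullForm H l hq) hp]
    have hext := extd_pullWithin (A := hamForm H l) uniqueDiffOn_solidTorus hp
      (solidTorus_subset_closure_interior hp) (f.contDiffOn_torusMap p hp) f.mapsTo_torusMap
      ((contDiffOn_hamForm hψ.hamiltonian hψ.primitive.smooth).differentiableOn (by simp) _ hfp)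
    have : ∀ u v w, contactVol solidTorus (fun q => (hamForm H l (f.torusMap q)).comp
        (fderivWithin ℝ f.torusMap solidTorus q)) p u v w =
        contactVol solidTorus (hamForm H l) (f.torusMap p)
          (fderivWithin ℝ f.torusMap solidTorus p u) (fderivWithin ℝ f.torusMap solidTorus p v)
          (fderivWithin ℝ f.torusMap solidTorus p w) := by
      intro u v w
      simp [contactVol, hext]
    rw [this, contactVol_eq_det3_mul]
    refine mul_pos ?_ (hψ.contact _ hfp)
    -- The determinant of `id × df` is that of `df`, which is one.
    have ha := f.area p.2 hp.2 1 Complex.I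
    simp only [f.fderivWithin_torusMap hp, det3]
    simp [omega] at ha ⊢
    linarith
  extends_over := by
    obtain ⟨δ, h0, h1, C, hC, hper, hcon, hpull⟩ := hψ.extends_over
    refine ⟨δ, h0, h1, C, hC, hper, hcon, fun b ρ ϑ hρ hρδ => ?_⟩
    have hρ1 : ρ < 1 := hρδ.trans_le h1
    rw [hpull b ρ ϑ hρ hρδ]
    have hev : ∀ᶠ x : ℝ × ℝ × ℝ in 𝓝 (b, ρ, ϑ), 0 < x.2.1 ∧ x.2.1 < 1 :=
      ((isOpen_Ioo (a := (0 : ℝ)) (b := 1)).preimage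
        (continuous_fst.comp continuous_snd)).mem_nhds (show (0 < ρ ∧ ρ < 1) from ⟨hρ, hρ1⟩)
    have hmem := bindingEmb_mem_openTorus h (g.comp f) (x := (b, ρ, ϑ)) hρ hρ1
    have heq : bindingEmb h g =ᶠ[𝓝 (b, ρ, ϑ)]
        fun x => f.torusMap (bindingEmb h (g.comp f) x) := by
      filter_upwards [hev] with x hx
      have := bindingEmb_mem_openTorus h g hx.1 hx.2
      rw [bindingEmb_comp]
      exact Prod.ext rfl (f.right_inv _ (openDisc_subset_disc this.2)).symm
    rw [pull_congr_of_eventuallyEq heq,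
      pull_comp (differentiableAt_bindingEmb h _ hρ hρ1)
        ((f.contDiffAt_torusMap hmem.2).differentiableAt (by simp))]
    unfold pull
    rw [f.hamForm_pullForm_eq_pull H l hmem]
    rfl

/-! ### Branches of the angular coordinate -/

/-- The vector `w ∈ ℂ` does not point in the direction opposite to `e^{ic}`. -/
def InSector (c : ℝ) (w : ℂ) : Prop :=
  Complex.exp ((-c : ℝ) * Complex.I) * w ∈ Complex.slitPlane

/-- The branch of the angular coordinate with values in `(c - π, c + π]`. -/
def angle (c : ℝ) (w : ℂ) : ℝ := c + Complex.arg (Complex.exp ((-c : ℝ) * Complex.I) * w)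

theorem exp_mul_I_add (a b : ℝ) : Complex.exp ((a + b : ℝ) * Complex.I) =
    Complex.exp (a * Complex.I) * Complex.exp (b * Complex.I) := by
  rw [← Complex.exp_add]
  push_cast
  ring_nf

theorem exp_neg_mul_I_mul (a : ℝ) (w : ℂ) : Complex.exp (a * Complex.I) *
    (Complex.exp ((-a : ℝ) * Complex.I) * w) = w := by
  rw [← mul_assoc, ← exp_mul_I_add]
  simp

theorem InSector.ne_zero {c : ℝ} {w : ℂ} (h : InSector c w) : w ≠ 0 := by
  rintro rfl
  simp [InSector] at h

theorem isOpen_inSector (c : ℝ) : IsOpen {w | InSector c w} :=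
  Complex.isOpen_slitPlane.preimage (continuous_const.mul continuous_id)

theorem inSector_mul_exp {r : ℝ} (hr : 0 < r) (c : ℝ) :
    InSector c (r * Complex.exp (c * Complex.I)) := by
  have : Complex.exp ((-c : ℝ) * Complex.I) * (r * Complex.exp (c * Complex.I)) = r := by
    rw [mul_left_comm, ← exp_mul_I_add]
    simp
  rw [InSector, this]
  exact Complex.ofReal_mem_slitPlane.2 hr

theorem inSector_arg {w : ℂ} (hw : w ≠ 0) : InSector (Complex.arg w) w := by
  have := inSector_mul_exp (norm_pos_iff.2 hw) (Complex.arg w)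
  rwa [Complex.norm_mul_exp_arg_mul_I] at this

theorem InSector.smul {c r : ℝ} {w : ℂ} (h : InSector c w) (hr : 0 < r) :
    InSector c (r • w) := by
  unfold InSector at *
  rw [mul_smul_comm]
  rw [Complex.mem_slitPlane_iff] at h ⊢
  simp only [Complex.smul_re, Complex.smul_im, smul_eq_mul]
  rcases h with h | h
  · exact Or.inl (mul_pos hr h)
  · exact Or.inr (mul_ne_zero hr.ne' h)

theorem angle_smul {c r : ℝ} {w : ℂ} (hr : 0 < r) : angle c (r • w) = angle c w := by
  unfold angle
  rw [mul_smul_comm, Complex.real_smul, Complex.arg_real_mul _ hr]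

theorem norm_mul_exp_angle (c : ℝ) (w : ℂ) : ‖w‖ * Complex.exp (angle c w * Complex.I) = w := by
  have h1 := Complex.norm_mul_exp_arg_mul_I (Complex.exp ((-c : ℝ) * Complex.I) * w)
  rw [norm_mul, Complex.norm_exp_ofReal_mul_I, one_mul] at h1
  rw [angle, exp_mul_I_add, mul_left_comm, h1, exp_neg_mul_I_mul]

theorem angle_mul_exp {c r s : ℝ} (hr : 0 < r) (h : |s - c| < Real.pi) :
    angle c (r * Complex.exp (s * Complex.I)) = s := by
  have h1 : Complex.exp ((-c : ℝ) * Complex.I) * (r * Complex.exp (s * Complex.I)) =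
      r * Complex.exp ((s - c : ℝ) * Complex.I) := by
    rw [mul_left_comm, ← exp_mul_I_add, sub_eq_add_neg, add_comm]
  rw [angle, h1, Complex.arg_real_mul _ hr, Complex.arg_exp_mul_I]
  have h2 : toIocMod Real.two_pi_pos (-Real.pi) (s - c) = s - c := by
    rw [toIocMod_eq_self]
    constructor <;> linarith [abs_lt.1 h]
  rw [h2]
  ring

theorem contDiffAt_angle {c : ℝ} {w : ℂ} (h : InSector c w) : ContDiffAt ℝ ∞ (angle c) w := by
  have h1 : ContDiffAt ℝ ∞ Complex.log (Complex.exp ((-c : ℝ) * Complex.I) * w) :=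
    (Complex.contDiffAt_log (n := ∞) h).restrict_scalars ℝ
  have h2 : ContDiffAt ℝ ∞ (fun w => Complex.exp ((-c : ℝ) * Complex.I) * w) w :=
    contDiffAt_const.mul contDiffAt_id
  have h3 := Complex.imCLM.contDiff.contDiffAt.comp w (h1.comp w h2)
  have h4 : angle c = fun w => c + (Complex.imCLM ∘ Complex.log ∘
      fun w => Complex.exp ((-c : ℝ) * Complex.I) * w) w := by
    funext w
    simp [angle, Complex.log_im]
  rw [h4]
  exact contDiffAt_const.add h3

theorem exp_mul_I_eq_iff {a b : ℝ} : Complex.exp (a * Complex.I) = Complex.exp (b * Complex.I) ↔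
    ∃ n : ℤ, a = b + n * (2 * Real.pi) := by
  rw [Complex.exp_eq_exp_iff_exists_int]
  refine exists_congr fun n => ?_
  rw [show (b * Complex.I + n * (2 * Real.pi * Complex.I) : ℂ) =
    ((b + n * (2 * Real.pi) : ℝ) : ℂ) * Complex.I by push_cast; ring]
  rw [mul_left_inj' Complex.I_ne_zero, Complex.ofReal_inj]

theorem exp_angle_eq {w : ℂ} (hw : w ≠ 0) (c c' : ℝ) :
    Complex.exp (angle c w * Complex.I) = Complex.exp (angle c' w * Complex.I) := by
  have := (norm_mul_exp_angle c w).trans (norm_mul_exp_angle c' w).symm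
  exact mul_left_cancel₀ (by simpa using hw) this

/-- Two branches of the angular coordinate differ locally by a constant multiple of `2π`. -/
theorem angle_eventuallyEq {c c' : ℝ} {w : ℂ} (h : InSector c w) (h' : InSector c' w) :
    ∃ n : ℤ, angle c =ᶠ[𝓝 w] fun v => angle c' v + n * (2 * Real.pi) := by
  obtain ⟨n, hn⟩ := exp_mul_I_eq_iff.1 (exp_angle_eq h.ne_zero c c')
  refine ⟨n, ?_⟩
  have hcont : ContinuousAt (fun v => angle c v - angle c' v) w :=
    (contDiffAt_angle h).continuousAt.sub (contDiffAt_angle h').continuousAt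
  filter_upwards [Metric.continuousAt_iff'.1 hcont _ Real.two_pi_pos,
    (isOpen_inSector c).mem_nhds h] with v hv hvs
  obtain ⟨m, hm⟩ := exp_mul_I_eq_iff.1 (exp_angle_eq hvs.ne_zero c c')
  rw [hm, hn, Real.dist_eq] at hv
  have h1 : |((m - n : ℤ) : ℝ)| < 1 := by
    have h2 : angle c' v + m * (2 * Real.pi) - angle c' v - (angle c' w + n * (2 * Real.pi) -
        angle c' w) = ((m - n : ℤ) : ℝ) * (2 * Real.pi) := by push_cast; ring
    rw [h2, abs_mul, abs_of_pos Real.two_pi_pos] at hv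
    nlinarith [Real.two_pi_pos]
  have h3 : m - n = 0 := Int.abs_lt_one_iff.1 (by exact_mod_cast h1)
  rw [hm, sub_eq_zero.1 h3]

/-! ### The unit sphere -/

/-- The Euclidean norm of `ℂ² = ℝ⁴`. -/
def nrm (p : ℂ × ℂ) : ℝ := √(‖p.1‖ ^ 2 + ‖p.2‖ ^ 2)

/-- The radial retraction of `ℂ² ∖ {0}` onto `S³`. -/
def rad (p : ℂ × ℂ) : ℂ × ℂ := (nrm p)⁻¹ • p

theorem sum_sq_pos {p : ℂ × ℂ} (hp : p ≠ 0) : 0 < ‖p.1‖ ^ 2 + ‖p.2‖ ^ 2 := by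
  by_contra h
  have h1 : ‖p.1‖ ^ 2 = 0 := by nlinarith [sq_nonneg ‖p.1‖, sq_nonneg ‖p.2‖]
  have h2 : ‖p.2‖ ^ 2 = 0 := by nlinarith [sq_nonneg ‖p.1‖, sq_nonneg ‖p.2‖]
  exact hp (Prod.ext (by simpa using h1) (by simpa using h2))

theorem nrm_pos {p : ℂ × ℂ} (hp : p ≠ 0) : 0 < nrm p := Real.sqrt_pos.2 (sum_sq_pos hp)

theorem rad_mem_sphere3 {p : ℂ × ℂ} (hp : p ≠ 0) : rad p ∈ sphere3 := by
  have h := nrm_pos hp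
  have h2 : nrm p ^ 2 = ‖p.1‖ ^ 2 + ‖p.2‖ ^ 2 := Real.sq_sqrt (sum_sq_pos hp).le
  simp only [sphere3, mem_ofPred_eq, rad, Prod.smul_fst, Prod.smul_snd, norm_smul, mul_pow,
    norm_inv, Real.norm_eq_abs, abs_of_pos h]
  rw [← mul_add, ← h2]
  field_simp

theorem nrm_of_mem_sphere3 {p : ℂ × ℂ} (hp : p ∈ sphere3) : nrm p = 1 := by
  rw [nrm, show ‖p.1‖ ^ 2 + ‖p.2‖ ^ 2 = 1 from hp, Real.sqrt_one]

theorem rad_of_mem_sphere3 {p : ℂ × ℂ} (hp : p ∈ sphere3) : rad p = p := by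
  rw [rad, nrm_of_mem_sphere3 hp, inv_one, one_smul]

theorem ne_zero_of_mem_sphere3 {p : ℂ × ℂ} (hp : p ∈ sphere3) : p ≠ 0 := by
  rintro rfl
  simp [sphere3] at hp

theorem norm_snd_eq_one_of_mem_sphere3 {p : ℂ × ℂ} (hp : p ∈ sphere3) (h : p.1 = 0) :
    ‖p.2‖ = 1 := by
  have h1 : ‖p.1‖ ^ 2 + ‖p.2‖ ^ 2 = 1 := hp
  rw [h, norm_zero] at h1
  nlinarith [norm_nonneg p.2]

theorem contDiffAt_nrm {p : ℂ × ℂ} (hp : p ≠ 0) : ContDiffAt ℝ ∞ nrm p :=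
  ((contDiffAt_fst.norm_sq ℝ).add (contDiffAt_snd.norm_sq ℝ)).sqrt (sum_sq_pos hp).ne'

theorem contDiffAt_rad {p : ℂ × ℂ} (hp : p ≠ 0) : ContDiffAt ℝ ∞ rad p :=
  ((contDiffAt_nrm hp).inv (nrm_pos hp).ne').smul contDiffAt_id

theorem hasFDerivAt_sum_sq (p : ℂ × ℂ) :
    HasFDerivAt (fun q : ℂ × ℂ => ‖q.1‖ ^ 2 + ‖q.2‖ ^ 2)
      ((2 : ℝ) • (innerSL ℝ p.1).comp (ContinuousLinearMap.fst ℝ ℂ ℂ) +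
        (2 : ℝ) • (innerSL ℝ p.2).comp (ContinuousLinearMap.snd ℝ ℂ ℂ)) p := by
  have h1 := (hasFDerivAt_fst (𝕜 := ℝ) (p := p)).norm_sq
  have h2 := (hasFDerivAt_snd (𝕜 := ℝ) (p := p)).norm_sq
  refine (h1.add h2).congr_fderiv ?_
  rw [← Nat.cast_smul_eq_nsmul ℝ, ← Nat.cast_smul_eq_nsmul ℝ]
  rfl

theorem isTangent_iff {p u : ℂ × ℂ} :
    IsTangent p u ↔ ((2 : ℝ) • (innerSL ℝ p.1).comp (ContinuousLinearMap.fst ℝ ℂ ℂ) +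
        (2 : ℝ) • (innerSL ℝ p.2).comp (ContinuousLinearMap.snd ℝ ℂ ℂ)) u = 0 := by
  simp [IsTangent, Complex.inner]
  constructor <;> intro h <;> linarith

/-- The retraction onto `S³` is infinitesimally the identity on `TS³`. -/
theorem fderiv_rad {p u : ℂ × ℂ} (hp : p ∈ sphere3) (hu : IsTangent p u) :
    fderiv ℝ rad p u = u := by
  have hp0 := ne_zero_of_mem_sphere3 hp
  have h1 : HasFDerivAt nrm _ p := (hasFDerivAt_sum_sq p).sqrt (sum_sq_pos hp0).ne'
  have hi := (hasDerivAt_inv (nrm_pos hp0).ne').comp_hasFDerivAt p h1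
  have h3 : HasFDerivAt rad _ p := hi.smul (hasFDerivAt_id p)
  rw [h3.fderiv]
  have ht := isTangent_iff.1 hu
  rw [add_apply, smul_apply, ContinuousLinearMap.smulRight_apply, smul_apply, smul_apply, ht]
  simp [nrm_of_mem_sphere3 hp]

/-- Maps into `S³` have derivatives tangent to `S³`. -/
theorem isTangent_fderiv {E : Type*} [NormedAddCommGroup E] [NormedSpace ℝ E] {f : E → ℂ × ℂ}
    {x : E} (hf : DifferentiableAt ℝ f x) (h : ∀ᶠ y in 𝓝 x, f y ∈ sphere3) (v : E) :
    IsTangent (f x) (fderiv ℝ f x v) := by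
  have h1 := (hasFDerivAt_sum_sq (f x)).comp x hf.hasFDerivAt
  have h2 : ((fun q : ℂ × ℂ => ‖q.1‖ ^ 2 + ‖q.2‖ ^ 2) ∘ f) =ᶠ[𝓝 x] fun _ => 1 := h
  have h3 := h1.unique ((hasFDerivAt_const (1 : ℝ) x).congr_of_eventuallyEq h2)
  rw [isTangent_iff]
  exact congrArg (fun L : E →L[ℝ] ℝ => L v) h3

/-! ### The cut map and its charts -/

/-- The quotient map `S¹ × D² → S³` of the cut construction, for `g = id`. The boundary orbits of
`∂_s - h ∂_θ` become those of `∂_s` under `(s, z) ↦ (s, e^{ihs} z)`, and are collapsed by the factor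
`√(1 - |z|²)`. -/
def cutMap (h : ℕ) (p : ℝ × ℂ) : ℂ × ℂ :=
  (√(1 - ‖p.2‖ ^ 2) * Complex.exp (p.1 * Complex.I),
    Complex.exp ((h * p.1 : ℝ) * Complex.I) * p.2)

/-- The parametrisation of a neighbourhood of the binding `{0} × S¹` in `S³`. -/
def bindMap (p : ℝ × ℂ) : ℂ × ℂ :=
  (√(2 - ‖p.2‖ ^ 2) * p.2, (1 - ‖p.2‖ ^ 2 : ℝ) * Complex.exp (p.1 * Complex.I))

/-- Radially constant local inverses of `cutMap h`. -/
def cutChart (h : ℕ) (c : ℝ) (p : ℂ × ℂ) : ℝ × ℂ :=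
  (angle c (rad p).1, Complex.exp ((-(h * angle c (rad p).1) : ℝ) * Complex.I) * (rad p).2)

/-- Radially constant local inverses of `bindMap`. -/
def bindChart (c : ℝ) (p : ℂ × ℂ) : ℝ × ℂ :=
  (angle c (rad p).2, (√(1 + ‖(rad p).2‖))⁻¹ • (rad p).1)

theorem cutMap_mem_sphere3 (h : ℕ) {p : ℝ × ℂ} (hp : p.2 ∈ disc) : cutMap h p ∈ sphere3 := by
  have h1 := mem_disc.1 hp
  have h2 : 0 ≤ 1 - ‖p.2‖ ^ 2 := by nlinarith [norm_nonneg p.2]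
  simp only [sphere3, mem_ofPred_eq, cutMap, norm_mul, Complex.norm_exp_ofReal_mul_I, mul_one,
    one_mul, Complex.norm_real, Real.norm_eq_abs, sq_abs, Real.sq_sqrt h2]
  ring

theorem bindMap_mem_sphere3 {p : ℝ × ℂ} (hp : ‖p.2‖ < 1) : bindMap p ∈ sphere3 := by
  have h2 : 0 ≤ 2 - ‖p.2‖ ^ 2 := by nlinarith [norm_nonneg p.2]
  simp only [sphere3, mem_ofPred_eq, bindMap, norm_mul, Complex.norm_exp_ofReal_mul_I, mul_one,
    Complex.norm_real, Real.norm_eq_abs, sq_abs, mul_pow, Real.sq_sqrt h2]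
  ring

theorem continuous_cutMap (h : ℕ) : Continuous (cutMap h) := by
  unfold cutMap
  fun_prop

theorem ofReal_contDiff {n : WithTop ℕ∞} : ContDiff ℝ n (fun r : ℝ => (r : ℂ)) :=
  Complex.ofRealCLM.contDiff

theorem contDiff_expI {n : WithTop ℕ∞} : ContDiff ℝ n (fun r : ℝ => Complex.exp (r * Complex.I)) :=
  Complex.contDiff_exp.comp (ofReal_contDiff.mul contDiff_const)

theorem contDiffAt_cutMap (h : ℕ) {p : ℝ × ℂ} (hp : p.2 ∈ openDisc) :
    ContDiffAt ℝ ∞ (cutMap h) p := by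
  have h1 := mem_openDisc.1 hp
  have h2 : 0 < 1 - ‖p.2‖ ^ 2 := by nlinarith [norm_nonneg p.2]
  have h3 : ContDiffAt ℝ ∞ (fun p : ℝ × ℂ => √(1 - ‖p.2‖ ^ 2)) p :=
    (contDiffAt_const.sub (contDiffAt_snd.norm_sq ℝ)).sqrt h2.ne'
  refine ContDiffAt.prodMk ?_ ?_
  · exact (ofReal_contDiff.contDiffAt.comp p h3).mul
      (contDiff_expI.contDiffAt.comp p contDiffAt_fst)
  · exact (contDiff_expI.contDiffAt.comp p (contDiffAt_const.mul contDiffAt_fst)).mul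
      contDiffAt_snd

theorem contDiffAt_bindMap {p : ℝ × ℂ} (hp : ‖p.2‖ < 1) : ContDiffAt ℝ ∞ bindMap p := by
  have h2 : 0 < 2 - ‖p.2‖ ^ 2 := by nlinarith [norm_nonneg p.2]
  have h3 : ContDiffAt ℝ ∞ (fun p : ℝ × ℂ => √(2 - ‖p.2‖ ^ 2)) p :=
    (contDiffAt_const.sub (contDiffAt_snd.norm_sq ℝ)).sqrt h2.ne'
  refine ContDiffAt.prodMk ?_ ?_
  · exact (ofReal_contDiff.contDiffAt.comp p h3).mul contDiffAt_snd
  · exact (ofReal_contDiff.contDiffAt.comp p (contDiffAt_const.sub (contDiffAt_snd.norm_sq ℝ))).mul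
      (contDiff_expI.contDiffAt.comp p contDiffAt_fst)

theorem inSector_rad_fst {c : ℝ} {p : ℂ × ℂ} (hp : p ≠ 0) (h : InSector c p.1) :
    InSector c (rad p).1 := h.smul (inv_pos.2 (nrm_pos hp))

theorem inSector_rad_snd {c : ℝ} {p : ℂ × ℂ} (hp : p ≠ 0) (h : InSector c p.2) :
    InSector c (rad p).2 := h.smul (inv_pos.2 (nrm_pos hp))

theorem ne_zero_of_fst {p : ℂ × ℂ} (h : p.1 ≠ 0) : p ≠ 0 := by
  rintro rfl
  exact h rfl

theorem ne_zero_of_snd {p : ℂ × ℂ} (h : p.2 ≠ 0) : p ≠ 0 := by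
  rintro rfl
  exact h rfl

theorem rad_fst_ne_zero {p : ℂ × ℂ} (h : p.1 ≠ 0) : (rad p).1 ≠ 0 :=
  smul_ne_zero (inv_pos.2 (nrm_pos (ne_zero_of_fst h))).ne' h

theorem rad_snd_ne_zero {p : ℂ × ℂ} (h : p.2 ≠ 0) : (rad p).2 ≠ 0 :=
  smul_ne_zero (inv_pos.2 (nrm_pos (ne_zero_of_snd h))).ne' h

theorem norm_cutChart_sq (h : ℕ) (c : ℝ) {p : ℂ × ℂ} (hp : p ≠ 0) :
    ‖(cutChart h c p).2‖ ^ 2 = 1 - ‖(rad p).1‖ ^ 2 := by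
  have h1 : ‖(rad p).1‖ ^ 2 + ‖(rad p).2‖ ^ 2 = 1 := rad_mem_sphere3 hp
  simp only [cutChart, norm_mul, Complex.norm_exp_ofReal_mul_I, one_mul]
  linarith

theorem cutChart_mem_openDisc (h : ℕ) (c : ℝ) {p : ℂ × ℂ} (hp : p.1 ≠ 0) :
    (cutChart h c p).2 ∈ openDisc := by
  have h1 := norm_cutChart_sq h c (ne_zero_of_fst hp)
  have h2 := norm_pos_iff.2 (rad_fst_ne_zero hp)
  rw [mem_openDisc]
  nlinarith [norm_nonneg (cutChart h c p).2]

theorem cutMap_cutChart (h : ℕ) (c : ℝ) {p : ℂ × ℂ} (hp : p.1 ≠ 0) :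
    cutMap h (cutChart h c p) = rad p := by
  have h1 := norm_cutChart_sq h c (ne_zero_of_fst hp)
  refine Prod.ext ?_ ?_
  · simp only [cutMap, h1, sub_sub_cancel, Real.sqrt_sq (norm_nonneg _)]
    exact norm_mul_exp_angle c _
  · simp only [cutMap, cutChart]
    exact exp_neg_mul_I_mul _ _

theorem norm_bindChart_sq (c : ℝ) {p : ℂ × ℂ} (hp : p ≠ 0) :
    ‖(bindChart c p).2‖ ^ 2 = 1 - ‖(rad p).2‖ := by
  have h1 : ‖(rad p).1‖ ^ 2 + ‖(rad p).2‖ ^ 2 = 1 := rad_mem_sphere3 hp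
  have h2 : 0 < 1 + ‖(rad p).2‖ := by positivity
  have h3 : ‖(rad p).1‖ ^ 2 = (1 - ‖(rad p).2‖) * (1 + ‖(rad p).2‖) := by linarith
  simp only [bindChart, norm_smul, norm_inv, Real.norm_eq_abs, mul_pow, inv_pow, sq_abs,
    Real.sq_sqrt h2.le, h3]
  field_simp

theorem bindMap_bindChart (c : ℝ) {p : ℂ × ℂ} (hp : p ≠ 0) :
    bindMap (bindChart c p) = rad p := by
  have h1 := norm_bindChart_sq c hp
  have h2 : 0 < 1 + ‖(rad p).2‖ := by positivity
  refine Prod.ext ?_ ?_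
  · simp only [bindMap, h1]
    rw [show (2 : ℝ) - (1 - ‖(rad p).2‖) = 1 + ‖(rad p).2‖ by ring, ← Complex.real_smul]
    simp only [bindChart]
    rw [smul_smul, mul_inv_cancel₀ (Real.sqrt_pos.2 h2).ne', one_smul]
  · simp only [bindMap, h1, sub_sub_cancel]
    exact norm_mul_exp_angle c _

theorem contDiffAt_cutChart (h : ℕ) {c : ℝ} {p : ℂ × ℂ} (hp : InSector c p.1) :
    ContDiffAt ℝ ∞ (cutChart h c) p := by
  have hp0 := ne_zero_of_fst hp.ne_zero
  have hr := contDiffAt_rad hp0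
  have h1 : ContDiffAt ℝ ∞ (fun p => angle c (rad p).1) p :=
    ContDiffAt.comp (g := angle c) p (contDiffAt_angle (inSector_rad_fst hp0 hp))
      (contDiffAt_fst.comp p hr)
  exact h1.prodMk ((contDiff_expI.contDiffAt.comp p (contDiffAt_const.mul h1).neg).mul
    (contDiffAt_snd.comp p hr))

theorem contDiffAt_bindChart {c : ℝ} {p : ℂ × ℂ} (hp : InSector c p.2) :
    ContDiffAt ℝ ∞ (bindChart c) p := by
  have hp0 := ne_zero_of_snd hp.ne_zero
  have hr := contDiffAt_rad hp0
  have hr2 : ContDiffAt ℝ ∞ (fun p => (rad p).2) p := contDiffAt_snd.comp p hr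
  have h1 : ContDiffAt ℝ ∞ (fun p => angle c (rad p).2) p :=
    ContDiffAt.comp (g := angle c) p (contDiffAt_angle (inSector_rad_snd hp0 hp)) hr2
  have h2 : 0 < 1 + ‖(rad p).2‖ := by positivity
  have h3 : ContDiffAt ℝ ∞ (fun p => (√(1 + ‖(rad p).2‖))⁻¹) p :=
    ((contDiffAt_const.add (hr2.norm ℝ (rad_snd_ne_zero hp.ne_zero))).sqrt h2.ne').inv
      (Real.sqrt_pos.2 h2).ne'
  exact h1.prodMk (h3.smul (contDiffAt_fst.comp p hr))

theorem cutChart_cutMap (h : ℕ) {c : ℝ} {p : ℝ × ℂ} (hp : p.2 ∈ openDisc)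
    (hc : |p.1 - c| < Real.pi) : cutChart h c (cutMap h p) = p := by
  have h1 := mem_openDisc.1 hp
  have h2 : 0 < √(1 - ‖p.2‖ ^ 2) := Real.sqrt_pos.2 (by nlinarith [norm_nonneg p.2])
  have h3 : angle c (cutMap h p).1 = p.1 := angle_mul_exp h2 hc
  rw [cutChart, rad_of_mem_sphere3 (cutMap_mem_sphere3 h (openDisc_subset_disc hp)), h3]
  refine Prod.ext rfl ?_
  simpa [cutMap] using exp_neg_mul_I_mul (-(h * p.1)) p.2

theorem bindChart_bindMap {c : ℝ} {p : ℝ × ℂ} (hp : ‖p.2‖ < 1)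
    (hc : |p.1 - c| < Real.pi) : bindChart c (bindMap p) = p := by
  have h2 : 0 < 1 - ‖p.2‖ ^ 2 := by nlinarith [norm_nonneg p.2]
  have h3 : angle c (bindMap p).2 = p.1 := angle_mul_exp h2 hc
  have h4 : ‖(bindMap p).2‖ = 1 - ‖p.2‖ ^ 2 := by
    rw [bindMap, norm_mul, Complex.norm_exp_ofReal_mul_I, mul_one, Complex.norm_real,
      Real.norm_eq_abs, abs_of_pos h2]
  rw [bindChart, rad_of_mem_sphere3 (bindMap_mem_sphere3 hp), h3, h4]
  refine Prod.ext rfl ?_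
  have h5 : (1 : ℝ) + (1 - ‖p.2‖ ^ 2) = 2 - ‖p.2‖ ^ 2 := by ring
  have h6 : 0 < √(2 - ‖p.2‖ ^ 2) := Real.sqrt_pos.2 (by linarith)
  simp only [h5, bindMap]
  rw [← Complex.real_smul, smul_smul, inv_mul_cancel₀ h6.ne', one_smul]

/-- In polar coordinates around the binding, the cut map is `bindMap`. -/
theorem bindMap_polar (h : ℕ) {b ρ ϑ : ℝ} (h0 : 0 < ρ) (h1 : ρ < 1) :
    bindMap (polar (b, ρ, ϑ)) = cutMap h (bindingEmb h AreaDiffeo.refl (b, ρ, ϑ)) := by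
  have h2 : ‖(ρ : ℂ) * Complex.exp (ϑ * Complex.I)‖ = ρ := by
    rw [norm_mul, Complex.norm_exp_ofReal_mul_I, mul_one, Complex.norm_real, Real.norm_eq_abs,
      abs_of_pos h0]
  have h3 : ‖((1 - ρ ^ 2 : ℝ) : ℂ) * Complex.exp ((b - h * ϑ : ℝ) * Complex.I)‖ = 1 - ρ ^ 2 := by
    rw [norm_mul, Complex.norm_exp_ofReal_mul_I, mul_one, Complex.norm_real, Real.norm_eq_abs,
      abs_of_pos (by nlinarith)]
  have h4 : √(1 - (1 - ρ ^ 2) ^ 2) = √(2 - ρ ^ 2) * ρ := by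
    rw [show 1 - (1 - ρ ^ 2) ^ 2 = (2 - ρ ^ 2) * ρ ^ 2 by ring,
      Real.sqrt_mul (by nlinarith), Real.sqrt_sq h0.le]
  simp only [bindMap, cutMap, polar, bindingEmb, AreaDiffeo.refl, id, h2, h3, h4]
  refine Prod.ext ?_ ?_
  · push_cast
    ring
  · simp only
    rw [mul_left_comm, ← exp_mul_I_add]
    congr 4
    ring

theorem cutMap_add_period (h : ℕ) (s : ℝ) (n : ℤ) (z : ℂ) :
    cutMap h (s + n * (2 * Real.pi), z) = cutMap h (s, z) := by
  have h1 : Complex.exp ((s + n * (2 * Real.pi) : ℝ) * Complex.I) = Complex.exp (s * Complex.I) :=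
    exp_mul_I_eq_iff.2 ⟨n, rfl⟩
  have h2 : Complex.exp ((h * (s + n * (2 * Real.pi)) : ℝ) * Complex.I) =
      Complex.exp ((h * s : ℝ) * Complex.I) :=
    exp_mul_I_eq_iff.2 ⟨h * n, by push_cast; ring⟩
  simp only [cutMap, h1, h2]

theorem norm_sq_lt_one_iff {z : ℂ} : ‖z‖ ^ 2 < 1 ↔ z ∈ openDisc := by
  rw [mem_openDisc]
  exact ⟨fun h => by nlinarith [norm_nonneg z], fun h => by nlinarith [norm_nonneg z]⟩

theorem cutMap_fst_eq_zero_iff (h : ℕ) {s : ℝ} {z : ℂ} (hz : z ∈ disc) :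
    (cutMap h (s, z)).1 = 0 ↔ z ∈ circ := by
  rw [mem_circ_iff hz, ← norm_sq_lt_one_iff]
  simp [cutMap, Complex.exp_ne_zero, Real.sqrt_eq_zero']

theorem cutMap_eq_iff (h : ℕ) (s s' : ℝ) {z z' : ℂ} (hz : z ∈ disc) (hz' : z' ∈ disc) :
    cutMap h (s, z) = cutMap h (s', z') ↔
      (z = z' ∧ ∃ n : ℤ, s' = s + n * (2 * Real.pi)) ∨
      (z ∈ circ ∧ z' ∈ circ ∧
        z' = Complex.exp (((-(h * (s' - s)) : ℝ) : ℂ) * Complex.I) * z) := by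
  have hrot : z' = Complex.exp (((-(h * (s' - s)) : ℝ) : ℂ) * Complex.I) * z ↔
      (cutMap h (s, z)).2 = (cutMap h (s', z')).2 := by
    simp only [cutMap]
    rw [show -(h * (s' - s)) = -(h * s') + h * s by ring, exp_mul_I_add, mul_assoc]
    constructor
    · intro e
      rw [e, exp_neg_mul_I_mul]
    · intro e
      rw [e]
      simpa using (exp_neg_mul_I_mul (-(h * s')) z').symm
  constructor
  · intro e
    by_cases hc : z ∈ circ
    · have hc' : z' ∈ circ := by
        rw [← cutMap_fst_eq_zero_iff h hz' (s := s'), ← e]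
        exact (cutMap_fst_eq_zero_iff h hz).2 hc
      exact Or.inr ⟨hc, hc', hrot.2 (congrArg Prod.snd e)⟩
    · left
      have hn : ‖z‖ = ‖z'‖ := by
        have := congrArg (fun p : ℂ × ℂ => ‖p.2‖) e
        simpa only [cutMap, norm_mul, Complex.norm_exp_ofReal_mul_I, one_mul] using this
      have hpos : 0 < √(1 - ‖z‖ ^ 2) := by
        rw [mem_circ_iff hz, not_not, ← norm_sq_lt_one_iff] at hc
        exact Real.sqrt_pos.2 (by linarith)
      have h1 := congrArg Prod.fst e
      simp only [cutMap] at h1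
      rw [← hn] at h1
      have h2 := mul_left_cancel₀ (by exact_mod_cast hpos.ne') h1
      obtain ⟨n, hn⟩ := exp_mul_I_eq_iff.1 h2.symm
      refine ⟨?_, n, hn⟩
      have h3 := congrArg Prod.snd e
      rw [hn, cutMap_add_period] at h3
      exact mul_left_cancel₀ (Complex.exp_ne_zero _) h3
  · rintro (⟨rfl, n, rfl⟩ | ⟨hc, hc', e⟩)
    · rw [cutMap_add_period]
    · refine Prod.ext ?_ (hrot.1 e)
      rw [(cutMap_fst_eq_zero_iff h hz).2 hc, (cutMap_fst_eq_zero_iff h hz').2 hc']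

theorem cutMap_surj (h : ℕ) : cutMap h '' solidTorus = sphere3 := by
  refine Subset.antisymm ?_ ?_
  · rintro _ ⟨p, hp, rfl⟩
    exact cutMap_mem_sphere3 h hp.2
  · intro p hp
    by_cases h1 : p.1 = 0
    · have h2 := norm_snd_eq_one_of_mem_sphere3 hp h1
      refine ⟨(0, p.2), ⟨mem_univ _, mem_disc.2 h2.le⟩, ?_⟩
      exact Prod.ext (by simp [cutMap, h2, h1]) (by simp [cutMap])
    · exact ⟨cutChart h 0 p, ⟨mem_univ _, openDisc_subset_disc (cutChart_mem_openDisc h 0 h1)⟩,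
        by rw [cutMap_cutChart h 0 h1, rad_of_mem_sphere3 hp]⟩

theorem eventually_abs_sub_lt_pi (p : ℝ × ℂ) : ∀ᶠ q : ℝ × ℂ in 𝓝 p, |q.1 - p.1| < Real.pi := by
  have : ContinuousAt (fun q : ℝ × ℂ => |q.1 - p.1|) p := by fun_prop
  exact this.eventually_lt continuousAt_const (by simpa using Real.pi_pos)

theorem cutMap_fst_inSector (h : ℕ) {p : ℝ × ℂ} (hp : p.2 ∈ openDisc) :
    InSector p.1 (cutMap h p).1 :=
  inSector_mul_exp (Real.sqrt_pos.2 (by linarith [norm_sq_lt_one_iff.2 hp])) p.1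

theorem bindMap_snd_inSector {p : ℝ × ℂ} (hp : ‖p.2‖ < 1) : InSector p.1 (bindMap p).2 :=
  inSector_mul_exp (by linarith [norm_sq_lt_one_iff.2 (mem_openDisc.2 hp)]) p.1

theorem cutChart_cutMap_eventually (h : ℕ) {p : ℝ × ℂ} (hp : p.2 ∈ openDisc) :
    ∀ᶠ q in 𝓝 p, cutChart h p.1 (cutMap h q) = q := by
  filter_upwards [eventually_abs_sub_lt_pi p,
    isOpen_openTorus.mem_nhds (show p ∈ openTorus from ⟨mem_univ _, hp⟩)] with q hq hq2
  exact cutChart_cutMap h hq2.2 hq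

theorem bindChart_bindMap_eventually {p : ℝ × ℂ} (hp : ‖p.2‖ < 1) :
    ∀ᶠ q in 𝓝 p, bindChart p.1 (bindMap q) = q := by
  have : ContinuousAt (fun q : ℝ × ℂ => ‖q.2‖) p := by fun_prop
  filter_upwards [eventually_abs_sub_lt_pi p, this.eventually_lt continuousAt_const hp]
    with q hq hq2
  exact bindChart_bindMap hq2 hq

theorem fderiv_cutMap_injective (h : ℕ) {p : ℝ × ℂ} (hp : p.2 ∈ openDisc) :
    Function.Injective (fderiv ℝ (cutMap h) p) :=
  fderiv_injective_of_leftInverse ((contDiffAt_cutMap h hp).differentiableAt (by simp))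
    ((contDiffAt_cutChart h (cutMap_fst_inSector h hp)).differentiableAt (by simp))
    (cutChart_cutMap_eventually h hp)

theorem fderiv_bindMap_injective {p : ℝ × ℂ} (hp : ‖p.2‖ < 1) :
    Function.Injective (fderiv ℝ bindMap p) :=
  fderiv_injective_of_leftInverse ((contDiffAt_bindMap hp).differentiableAt (by simp))
    ((contDiffAt_bindChart (bindMap_snd_inSector hp)).differentiableAt (by simp))
    (bindChart_bindMap_eventually hp)

/-- If `m ∘ f` is the retraction onto `S³`, then `df` is injective on the tangent spaces of `S³`. -/
theorem linearIndependent_fderiv {f : ℂ × ℂ → ℝ × ℂ} {m : ℝ × ℂ → ℂ × ℂ} {p u v w : ℂ × ℂ}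
    (hp : p ∈ sphere3) (hf : DifferentiableAt ℝ f p) (hm : DifferentiableAt ℝ m (f p))
    (h : ∀ᶠ q in 𝓝 p, m (f q) = rad q) (hu : IsTangent p u) (hv : IsTangent p v)
    (hw : IsTangent p w) (hli : LinearIndependent ℝ ![u, v, w]) :
    LinearIndependent ℝ ![fderiv ℝ f p u, fderiv ℝ f p v, fderiv ℝ f p w] := by
  have h1 : ∀ x, IsTangent p x → fderiv ℝ m (f p) (fderiv ℝ f p x) = x := by
    intro x hx
    have h2 : (m ∘ f) =ᶠ[𝓝 p] rad := h
    have h3 := h2.fderiv_eq (𝕜 := ℝ)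
    rw [fderiv_comp p hm hf] at h3
    rw [← ContinuousLinearMap.comp_apply, h3, fderiv_rad hp hx]
  refine LinearIndependent.of_comp (fderiv ℝ m (f p)).toLinearMap ?_
  have h4 : (fderiv ℝ m (f p)).toLinearMap ∘ ![fderiv ℝ f p u, fderiv ℝ f p v, fderiv ℝ f p w] =
      ![u, v, w] := by
    ext1 i
    fin_cases i
    · exact h1 u hu
    · exact h1 v hv
    · exact h1 w hw
  rw [h4]
  exact hli

/-! ### The contact form on the sphere -/

/-- Contact forms `α` on `ℝ × Int D²` and `C` near the binding, both `2π`-periodic in the first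
coordinate, that correspond to each other under the gluing map `Φ`. -/
structure IsGluingPair (h : ℕ) (δ : ℝ) (α C : ℝ × ℂ → ℝ × ℂ →L[ℝ] ℝ) : Prop where
  le_one : δ ≤ 1
  smooth : ContDiffOn ℝ ∞ α openTorus
  periodic : ∀ s, ∀ z ∈ openDisc, α (s + 2 * Real.pi, z) = α (s, z)
  contact : ∀ p ∈ openTorus, contactVol univ α p (1, 0) (0, 1) (0, Complex.I) ≠ 0
  smooth_bind : ContDiffOn ℝ ∞ C (univ ×ˢ Metric.ball 0 δ)
  periodic_bind : ∀ b w, C (b + 2 * Real.pi, w) = C (b, w)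
  contact_bind : ∀ p : ℝ × ℂ, ‖p.2‖ < δ →
    contactVol univ C p (1, 0) (0, 1) (0, Complex.I) ≠ 0
  glue : ∀ b ρ ϑ : ℝ, 0 < ρ → ρ < δ →
    pull polar C (b, ρ, ϑ) = pull (bindingEmb h AreaDiffeo.refl) α (b, ρ, ϑ)

/-- The one-form on `ℂ² ∖ {0}` that is glued from `α` and `C` through the charts of `S³`. The
branches of the charts are chosen pointwise. -/
def sphereForm (h : ℕ) (α C : ℝ × ℂ → ℝ × ℂ →L[ℝ] ℝ) (p : ℂ × ℂ) : ℂ × ℂ →L[ℝ] ℝ :=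
  open Classical in
  if p.1 = 0 then pull (bindChart (Complex.arg p.2)) C p
  else pull (cutChart h (Complex.arg p.1)) α p

theorem cutChart_eventuallyEq (h : ℕ) {c c' : ℝ} {p : ℂ × ℂ} (hc : InSector c p.1)
    (hc' : InSector c' p.1) : ∃ n : ℤ, cutChart h c =ᶠ[𝓝 p]
      fun q => cutChart h c' q + ((n * (2 * Real.pi) : ℝ), (0 : ℂ)) := by
  have hp := ne_zero_of_fst hc.ne_zero
  obtain ⟨n, hn⟩ := angle_eventuallyEq (inSector_rad_fst hp hc) (inSector_rad_fst hp hc')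
  refine ⟨n, ?_⟩
  have hcont : Tendsto (fun q => (rad q).1) (𝓝 p) (𝓝 (rad p).1) :=
    continuousAt_fst.comp (contDiffAt_rad hp).continuousAt
  filter_upwards [hcont.eventually hn] with q hq
  refine Prod.ext hq ?_
  simp only [cutChart, Prod.snd_add, add_zero]
  rw [hq]
  congr 1
  exact exp_mul_I_eq_iff.2 ⟨-(h * n), by push_cast; ring⟩

theorem bindChart_eventuallyEq {c c' : ℝ} {p : ℂ × ℂ} (hc : InSector c p.2)
    (hc' : InSector c' p.2) : ∃ n : ℤ, bindChart c =ᶠ[𝓝 p]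
      fun q => bindChart c' q + ((n * (2 * Real.pi) : ℝ), (0 : ℂ)) := by
  have hp := ne_zero_of_snd hc.ne_zero
  obtain ⟨n, hn⟩ := angle_eventuallyEq (inSector_rad_snd hp hc) (inSector_rad_snd hp hc')
  refine ⟨n, ?_⟩
  have hcont : Tendsto (fun q => (rad q).2) (𝓝 p) (𝓝 (rad p).2) :=
    continuousAt_snd.comp (contDiffAt_rad hp).continuousAt
  filter_upwards [hcont.eventually hn] with q hq
  refine Prod.ext hq ?_
  simp [bindChart]

/-- Radius and angle around the binding, and angle along it, as functions on `ℂ² ∖ {0}`. -/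
def polarChart (c c' : ℝ) (p : ℂ × ℂ) : ℝ × ℝ × ℝ :=
  (angle c (rad p).2, ‖(bindChart c p).2‖, angle c' (rad p).1)

theorem polar_polarChart (c c' : ℝ) (p : ℂ × ℂ) : polar (polarChart c c' p) = bindChart c p := by
  refine Prod.ext rfl ?_
  have h2 : 0 < 1 + ‖(rad p).2‖ := by positivity
  have h1 : angle c' (rad p).1 = angle c' (bindChart c p).2 :=
    (angle_smul (inv_pos.2 (Real.sqrt_pos.2 h2))).symm
  simp only [polar, polarChart, h1]
  exact norm_mul_exp_angle c' _

theorem bindingEmb_polarChart (h : ℕ) (c c' : ℝ) {p : ℂ × ℂ} (hp : p ≠ 0) :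
    bindingEmb h AreaDiffeo.refl (polarChart c c' p) = cutChart h c' p := by
  refine Prod.ext rfl ?_
  simp only [bindingEmb, polarChart, cutChart, AreaDiffeo.refl, id, norm_bindChart_sq c hp,
    sub_sub_cancel]
  conv_rhs => rw [← norm_mul_exp_angle c (rad p).2]
  rw [mul_left_comm, ← exp_mul_I_add]
  congr 4
  ring

theorem bindChart_snd_eq_zero {c : ℝ} {p : ℂ × ℂ} (hp : p.1 = 0) :
    (bindChart c p).2 = 0 := by
  simp [bindChart, rad, hp]

theorem polarChart_differentiableAt {c c' : ℝ} {p : ℂ × ℂ} (hc : InSector c p.2)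
    (hc' : InSector c' p.1) : DifferentiableAt ℝ (polarChart c c') p := by
  have h1 := (contDiffAt_bindChart hc).differentiableAt (by simp)
  have h2 := (contDiffAt_cutChart 0 hc').differentiableAt (by simp)
  have hp := ne_zero_of_fst hc'.ne_zero
  have h3 : (bindChart c p).2 ≠ 0 :=
    smul_ne_zero (inv_ne_zero (Real.sqrt_pos.2 (by positivity)).ne') (rad_fst_ne_zero hc'.ne_zero)
  exact h1.fst.prodMk ((h1.snd.norm ℝ h3).prodMk h2.fst)

theorem differentiable_polar : Differentiable ℝ polar := by
  have e : ∀ r : ℝ, (r : ℂ) = Complex.ofRealCLM r := fun _ => rfl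
  unfold polar
  simp only [e]
  fun_prop

namespace IsGluingPair

variable {h : ℕ} {δ : ℝ} {α C : ℝ × ℂ → ℝ × ℂ →L[ℝ] ℝ}

theorem periodic_int (hg : IsGluingPair h δ α C) (s : ℝ) {z : ℂ} (hz : z ∈ openDisc) (n : ℤ) :
    α (s + n * (2 * Real.pi), z) = α (s, z) :=
  (show Function.Periodic (fun s => α (s, z)) (2 * Real.pi) from
    fun s => hg.periodic s z hz).int_mul n s

theorem periodic_bind_int (hg : IsGluingPair h δ α C) (b : ℝ) (w : ℂ) (n : ℤ) :
    C (b + n * (2 * Real.pi), w) = C (b, w) :=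
  (show Function.Periodic (fun s => C (s, w)) (2 * Real.pi) from
    fun s => hg.periodic_bind s w).int_mul n b

theorem contDiffAt (hg : IsGluingPair h δ α C) {p : ℝ × ℂ} (hp : p.2 ∈ openDisc) :
    ContDiffAt ℝ ∞ α p :=
  hg.smooth.contDiffAt (isOpen_openTorus.mem_nhds ⟨mem_univ _, hp⟩)

theorem contDiffAt_bind (hg : IsGluingPair h δ α C) {p : ℝ × ℂ} (hp : ‖p.2‖ < δ) :
    ContDiffAt ℝ ∞ C p :=
  hg.smooth_bind.contDiffAt
    ((isOpen_univ.prod Metric.isOpen_ball).mem_nhds ⟨mem_univ _, by simpa using hp⟩)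

theorem sphereForm_eq_cut (hg : IsGluingPair h δ α C) {c : ℝ} {p : ℂ × ℂ} (hc : InSector c p.1) :
    sphereForm h α C p = pull (cutChart h c) α p := by
  rw [sphereForm, if_neg hc.ne_zero]
  obtain ⟨n, hn⟩ := cutChart_eventuallyEq h (inSector_arg hc.ne_zero) hc
  refine pull_congr_of_eventuallyEq_add hn ?_
  have := hg.periodic_int (cutChart h c p).1 (cutChart_mem_openDisc h c hc.ne_zero) n
  rwa [← add_zero (cutChart h c p).2, ← Prod.mk_add_mk, add_zero] at this

theorem sphereForm_eq_bind (hg : IsGluingPair h δ α C) {c : ℝ} {p : ℂ × ℂ} (hc : InSector c p.2)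
    (hδ : ‖(bindChart c p).2‖ < δ) : sphereForm h α C p = pull (bindChart c) C p := by
  by_cases hp1 : p.1 = 0
  · rw [sphereForm, if_pos hp1]
    obtain ⟨n, hn⟩ := bindChart_eventuallyEq (inSector_arg hc.ne_zero) hc
    refine pull_congr_of_eventuallyEq_add hn ?_
    have := hg.periodic_bind_int (bindChart c p).1 (bindChart c p).2 n
    rwa [← add_zero (bindChart c p).2, ← Prod.mk_add_mk, add_zero] at this
  -- Off the binding, both charts factor through polar coordinates around the binding.
  · have hc' := inSector_arg hp1
    have hp := ne_zero_of_fst hp1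
    rw [hg.sphereForm_eq_cut hc']
    have h0 : 0 < (polarChart c (Complex.arg p.1) p).2.1 :=
      norm_pos_iff.2 (smul_ne_zero (inv_ne_zero (Real.sqrt_pos.2 (by positivity)).ne')
        (rad_fst_ne_zero hp1))
    have h1 : (polarChart c (Complex.arg p.1) p).2.1 < 1 := hδ.trans_le hg.le_one
    have hd := polarChart_differentiableAt hc hc'
    have e1 : cutChart h (Complex.arg p.1) =ᶠ[𝓝 p]
        fun q => bindingEmb h AreaDiffeo.refl (polarChart c (Complex.arg p.1) q) := by
      filter_upwards [isOpen_ne.mem_nhds hp] with q hq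
      exact (bindingEmb_polarChart h c _ hq).symm
    have e2 : bindChart c = fun q => polar (polarChart c (Complex.arg p.1) q) :=
      funext fun q => (polar_polarChart c _ q).symm
    rw [e2, pull_comp hd (differentiable_polar _), pull_congr_of_eventuallyEq e1,
      pull_comp hd (differentiableAt_bindingEmb h _ h0 h1)]
    unfold pull
    have := hg.glue (polarChart c (Complex.arg p.1) p).1 _
      (polarChart c (Complex.arg p.1) p).2.2 h0 hδ
    unfold pull at this
    rw [← this]

theorem sphereForm_eventuallyEq_cut (hg : IsGluingPair h δ α C) {c : ℝ} {p : ℂ × ℂ}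
    (hc : InSector c p.1) : sphereForm h α C =ᶠ[𝓝 p] pull (cutChart h c) α := by
  filter_upwards [((isOpen_inSector c).preimage continuous_fst).mem_nhds hc] with q hq
  exact hg.sphereForm_eq_cut hq

theorem sphereForm_eventuallyEq_bind (hg : IsGluingPair h δ α C) {c : ℝ} {p : ℂ × ℂ}
    (hc : InSector c p.2) (hδ : ‖(bindChart c p).2‖ < δ) :
    sphereForm h α C =ᶠ[𝓝 p] pull (bindChart c) C := by
  have hcont : ContinuousAt (fun q => ‖(bindChart c q).2‖) p :=
    (continuousAt_snd.comp (contDiffAt_bindChart hc).continuousAt).norm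
  filter_upwards [((isOpen_inSector c).preimage continuous_snd).mem_nhds hc,
    hcont.eventually_lt continuousAt_const hδ] with q hq hq2
  exact hg.sphereForm_eq_bind hq hq2

theorem contDiffAt_sphereForm (hg : IsGluingPair h δ α C) (hδ : 0 < δ) {p : ℂ × ℂ} (hp : p ≠ 0) :
    ContDiffAt ℝ ∞ (sphereForm h α C) p := by
  by_cases hp1 : p.1 = 0
  · have hp2 : p.2 ≠ 0 := fun h2 => hp (Prod.ext hp1 h2)
    have hc := inSector_arg hp2
    have hb : ‖(bindChart (Complex.arg p.2) p).2‖ < δ := by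
      rwa [bindChart_snd_eq_zero hp1, norm_zero]
    exact (contDiffAt_pull (contDiffAt_bindChart hc) (hg.contDiffAt_bind hb)).congr_of_eventuallyEq
      (hg.sphereForm_eventuallyEq_bind hc hb)
  · have hc := inSector_arg hp1
    exact (contDiffAt_pull (contDiffAt_cutChart h hc)
      (hg.contDiffAt (cutChart_mem_openDisc h _ hp1))).congr_of_eventuallyEq
      (hg.sphereForm_eventuallyEq_cut hc)

theorem isContactFormS3 (hg : IsGluingPair h δ α C) (hδ : 0 < δ) :
    IsContactFormS3 (sphereForm h α C) where
  smooth := fun _ hp => (hg.contDiffAt_sphereForm hδ hp).contDiffWithinAt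
  contact := by
    intro p hp u v w hu hv hw hli
    have hp0 := ne_zero_of_mem_sphere3 hp
    rw [contactVol_of_mem_nhds (isOpen_compl_singleton.mem_nhds hp0)]
    by_cases hp1 : p.1 = 0
    · have hp2 : p.2 ≠ 0 := fun h2 => hp0 (Prod.ext hp1 h2)
      have hc := inSector_arg hp2
      have h0 : (bindChart (Complex.arg p.2) p).2 = 0 := bindChart_snd_eq_zero hp1
      have hb : ‖(bindChart (Complex.arg p.2) p).2‖ < δ := by rwa [h0, norm_zero]
      rw [contactVol_congr_of_eventuallyEq (hg.sphereForm_eventuallyEq_bind hc hb),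
        contactVol_pull (contDiffAt_bindChart hc)
          ((hg.contDiffAt_bind hb).differentiableAt (by simp)), contactVol_eq_det3_mul]
      refine mul_ne_zero (det3_ne_zero ?_) (hg.contact_bind _ hb)
      refine linearIndependent_fderiv (m := bindMap) hp
        ((contDiffAt_bindChart hc).differentiableAt (by simp))
        ((contDiffAt_bindMap (by simp [h0])).differentiableAt (by simp)) ?_ hu hv hw hli
      filter_upwards [isOpen_ne.mem_nhds hp0] with q hq
      exact bindMap_bindChart _ hq
    · have hc := inSector_arg hp1
      have hm := cutChart_mem_openDisc h (Complex.arg p.1) hp1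
      rw [contactVol_congr_of_eventuallyEq (hg.sphereForm_eventuallyEq_cut hc),
        contactVol_pull (contDiffAt_cutChart h hc)
          ((hg.contDiffAt hm).differentiableAt (by simp)), contactVol_eq_det3_mul]
      refine mul_ne_zero (det3_ne_zero ?_) (hg.contact _ ⟨mem_univ _, hm⟩)
      refine linearIndependent_fderiv (m := cutMap h) hp
        ((contDiffAt_cutChart h hc).differentiableAt (by simp))
        ((contDiffAt_cutMap h hm).differentiableAt (by simp)) ?_ hu hv hw hli
      filter_upwards [(isOpen_ne.preimage continuous_fst).mem_nhds hp1] with q hq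
      exact cutMap_cutChart h _ hq

theorem pull_cutMap_sphereForm (hg : IsGluingPair h δ α C) {p : ℝ × ℂ} (hp : p.2 ∈ openDisc) :
    pull (cutMap h) (sphereForm h α C) p = α p := by
  have hc := cutMap_fst_inSector h hp
  have hd := (contDiffAt_cutMap h hp).differentiableAt (n := ∞) (by simp)
  have hd2 := (contDiffAt_cutChart h hc).differentiableAt (by simp)
  apply ContinuousLinearMap.ext
  intro v
  have h1 := cutChart_cutMap_eventually h hp
  rw [pull, hg.sphereForm_eq_cut hc, ContinuousLinearMap.comp_apply, pull,
    ContinuousLinearMap.comp_apply, fderiv_comp_apply_of_leftInverse hd hd2 h1, h1.self_of_nhds]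

end IsGluingPair

theorem EmbedsByCut.isGluingPair {h : ℕ} {H : ℝ → ℂ → ℝ} {l : ℂ → ℂ →L[ℝ] ℝ} {ψ : AreaDiffeo}
    (hψ : EmbedsByCut h H l AreaDiffeo.refl ψ) :
    ∃ δ > 0, ∃ C, IsGluingPair h δ (hamForm H l) C := by
  obtain ⟨δ, h0, h1, C, hC, hper, hcon, hpull⟩ := hψ.extends_over
  refine ⟨δ, h0, C, h1, ?_, ?_, ?_, hC, hper, ?_, hpull⟩
  · exact (contDiffOn_hamForm hψ.hamiltonian hψ.primitive.smooth).mono openTorus_subset_solidTorus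
  · intro s z hz
    simp [hamForm, hψ.hamiltonian.periodic s z (openDisc_subset_disc hz)]
  · intro p hp
    have := hψ.contact p (openTorus_subset_solidTorus hp)
    rw [contactVol_of_mem_nhds (solidTorus_mem_nhds hp.2)] at this
    exact this.ne'
  · intro p hp
    have hp' : p ∈ univ ×ˢ Metric.ball (0 : ℂ) δ := ⟨mem_univ _, by simpa using hp⟩
    have := hcon p hp'
    rwa [contactVol_of_mem_nhds ((isOpen_univ.prod Metric.isOpen_ball).mem_nhds hp')] at this

/-! ### The Reeb direction of `H_s ds + l` -/

/-- The Hamiltonian vector field `X_s`, given by `ω(X_s, ·) = dH_s`. -/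
def hamVec (H : ℝ → ℂ → ℝ) (s : ℝ) (z : ℂ) : ℂ :=
  ⟨fderivWithin ℝ (H s) disc z Complex.I / 2, -(fderivWithin ℝ (H s) disc z 1 / 2)⟩

/-- The value `H_s + l(X_s)` of the form `H_s ds + l` on `∂_s + X_s`. -/
def reebSpeed (H : ℝ → ℂ → ℝ) (l : ℂ → ℂ →L[ℝ] ℝ) (s : ℝ) (z : ℂ) : ℝ :=
  H s z + l z (hamVec H s z)

theorem complex_clm_apply (L : ℂ →L[ℝ] ℝ) (v : ℂ) : L v = v.re * L 1 + v.im * L Complex.I := by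
  have hv : v = v.re • (1 : ℂ) + v.im • Complex.I := by
    apply Complex.ext <;> simp
  conv_lhs => rw [hv]
  simp only [map_add, map_smul, smul_eq_mul]

theorem omega_hamVec (H : ℝ → ℂ → ℝ) (s : ℝ) (z v : ℂ) :
    omega (hamVec H s z) v = fderivWithin ℝ (H s) disc z v := by
  rw [complex_clm_apply (fderivWithin ℝ (H s) disc z) v]
  simp only [omega, hamVec]
  ring

theorem eq_hamVec {H : ℝ → ℂ → ℝ} {s : ℝ} {z X : ℂ}
    (h : ∀ v, omega X v = fderivWithin ℝ (H s) disc z v) : X = hamVec H s z := by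
  refine sub_eq_zero.1 (omega_eq_zero fun v => ?_)
  have := (h v).trans (omega_hamVec H s z v).symm
  simp only [omega, Complex.sub_re, Complex.sub_im] at this ⊢
  linarith

section ReebDirection

variable {H : ℝ → ℂ → ℝ} {l : ℂ → ℂ →L[ℝ] ℝ}

theorem IsPeriodicHamiltonian.fderivWithin_slice (hH : IsPeriodicHamiltonian H) (s : ℝ) {z : ℂ}
    (hz : z ∈ disc) (v : ℂ) : fderivWithin ℝ (H s) disc z v =
      fderivWithin ℝ (fun p : ℝ × ℂ => H p.1 p.2) solidTorus (s, z) (0, v) := by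
  have h1 : DifferentiableWithinAt ℝ (fun p : ℝ × ℂ => H p.1 p.2) solidTorus (s, z) :=
    hH.smooth.differentiableOn (by simp) _ ⟨mem_univ _, hz⟩
  have h2 : HasFDerivWithinAt (fun w : ℂ => (s, w)) (ContinuousLinearMap.inr ℝ ℝ ℂ) disc z :=
    (hasFDerivAt_prodMk_right s z).hasFDerivWithinAt
  have h3 := h1.hasFDerivWithinAt.comp z h2 fun w hw => ⟨mem_univ _, hw⟩
  rw [show H s = (fun p : ℝ × ℂ => H p.1 p.2) ∘ (fun w : ℂ => (s, w)) from rfl,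
    h3.fderivWithin (uniqueDiffOn_disc z hz)]
  rfl

theorem extd_hamForm (hH : IsPeriodicHamiltonian H) (hl : IsPrimitive l) (s : ℝ) {z : ℂ}
    (hz : z ∈ disc) (u v : ℝ × ℂ) : extd solidTorus (hamForm H l) (s, z) u v =
      fderivWithin ℝ (H s) disc z u.2 * v.1 - fderivWithin ℝ (H s) disc z v.2 * u.1 +
        omega u.2 v.2 := by
  have hp : (s, z) ∈ solidTorus := ⟨mem_univ _, hz⟩
  have h1 : DifferentiableWithinAt ℝ (fun p : ℝ × ℂ => H p.1 p.2) solidTorus (s, z) :=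
    hH.smooth.differentiableOn (by simp) _ hp
  have h2 : DifferentiableWithinAt ℝ l disc z := hl.smooth.differentiableOn (by simp) z hz
  have h3 := h2.hasFDerivWithinAt.comp (s, z) (hasFDerivWithinAt_snd (s := solidTorus) (𝕜 := ℝ))
    fun p hp => hp.2
  have h4 := (h1.hasFDerivWithinAt.smul_const (ContinuousLinearMap.fst ℝ ℝ ℂ)).add
    (h3.clm_comp (hasFDerivWithinAt_const (ContinuousLinearMap.snd ℝ ℝ ℂ) (s, z) solidTorus))
  have h5 : fderivWithin ℝ (hamForm H l) solidTorus (s, z) = _ :=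
    HasFDerivWithinAt.fderivWithin h4 (uniqueDiffOn_solidTorus _ hp)
  have hD : ∀ u : ℝ × ℂ, fderivWithin ℝ (fun p : ℝ × ℂ => H p.1 p.2) solidTorus (s, z) u =
      u.1 * fderivWithin ℝ (fun p : ℝ × ℂ => H p.1 p.2) solidTorus (s, z) (1, 0) +
        fderivWithin ℝ (H s) disc z u.2 := by
    intro u
    have hu : u = u.1 • ((1, 0) : ℝ × ℂ) + (0, u.2) := by ext <;> simp
    conv_lhs => rw [hu]
    rw [map_add, map_smul, hH.fderivWithin_slice s hz, smul_eq_mul]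
  have hom := hl.primitive z hz u.2 v.2
  rw [← hom, extd, extd, h5]
  simp
  rw [hD u, hD v]
  ring

/-- The vector `∂_s + X_s` spans the kernel of `d(H_s ds + l)`. -/
theorem extd_hamForm_hamVec (hH : IsPeriodicHamiltonian H) (hl : IsPrimitive l) (s : ℝ) {z : ℂ}
    (hz : z ∈ disc) (v : ℝ × ℂ) :
    extd solidTorus (hamForm H l) (s, z) (1, hamVec H s z) v = 0 := by
  rw [extd_hamForm hH hl s hz, ← omega_hamVec, ← omega_hamVec]
  simp only [omega]
  ring

theorem contactVol_hamForm (hH : IsPeriodicHamiltonian H) (hl : IsPrimitive l) (s : ℝ) {z : ℂ}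
    (hz : z ∈ disc) : contactVol solidTorus (hamForm H l) (s, z) (1, 0) (0, 1) (0, Complex.I) =
      2 * reebSpeed H l s z := by
  have hX := complex_clm_apply (l z) (hamVec H s z)
  simp only [contactVol, extd_hamForm hH hl s hz, reebSpeed, hX]
  simp [hamForm, hamVec, omega]
  ring

theorem IsPeriodicHamiltonian.hamVec_add_period (hH : IsPeriodicHamiltonian H) (s : ℝ) {z : ℂ}
    (hz : z ∈ disc) : hamVec H (s + 2 * Real.pi) z = hamVec H s z := by
  have : fderivWithin ℝ (H (s + 2 * Real.pi)) disc z = fderivWithin ℝ (H s) disc z :=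
    fderivWithin_congr (fun w hw => hH.periodic s w hw) (hH.periodic s z hz)
  simp only [hamVec, this]

theorem IsPeriodicHamiltonian.hamVec_add_int (hH : IsPeriodicHamiltonian H) (s : ℝ) {z : ℂ}
    (hz : z ∈ disc) (n : ℤ) : hamVec H (s + n * (2 * Real.pi)) z = hamVec H s z :=
  (show Function.Periodic (fun s => hamVec H s z) (2 * Real.pi) from
    fun s => hH.hamVec_add_period s hz).int_mul n s

theorem IsPeriodicHamiltonian.reebSpeed_add_int (hH : IsPeriodicHamiltonian H) (s : ℝ) {z : ℂ}
    (hz : z ∈ disc) (n : ℤ) : reebSpeed H l (s + n * (2 * Real.pi)) z = reebSpeed H l s z :=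
  (show Function.Periodic (fun s => reebSpeed H l s z) (2 * Real.pi) from
    fun s => by simp only [reebSpeed, hH.periodic s z hz, hH.hamVec_add_period s hz]).int_mul n s

theorem continuousOn_reebSpeed (hH : IsPeriodicHamiltonian H) (hl : IsPrimitive l) :
    ContinuousOn (fun p : ℝ × ℂ => reebSpeed H l p.1 p.2) solidTorus := by
  have h1 : ∀ v : ℂ, ContinuousOn (fun p : ℝ × ℂ => fderivWithin ℝ (H p.1) disc p.2 v)
      solidTorus := by
    intro v
    have h2 := (hH.smooth.fderivWithin uniqueDiffOn_solidTorus (m := ∞) (by simp)).continuousOn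
    exact (h2.clm_apply (continuousOn_const (c := ((0, v) : ℝ × ℂ)))).congr
      fun p hp => hH.fderivWithin_slice p.1 hp.2 v
  have h3 : ∀ v : ℂ, ContinuousOn (fun p : ℝ × ℂ => l p.2 v) solidTorus := fun v =>
    (hl.smooth.continuousOn.comp continuousOn_snd fun p hp => hp.2).clm_apply continuousOn_const
  have h4 : (fun p : ℝ × ℂ => reebSpeed H l p.1 p.2) = fun p => H p.1 p.2 +
      (fderivWithin ℝ (H p.1) disc p.2 Complex.I / 2 * l p.2 1 +
        -(fderivWithin ℝ (H p.1) disc p.2 1 / 2) * l p.2 Complex.I) := by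
    funext p
    rw [reebSpeed, complex_clm_apply (l p.2)]
    rfl
  rw [h4]
  exact hH.smooth.continuousOn.add ((((h1 _).div_const 2).mul (h3 _)).add
    (((h1 _).div_const 2).neg.mul (h3 _)))

/-- Positivity of the contact form, made uniform by compactness of the solid torus. -/
theorem exists_le_reebSpeed (hH : IsPeriodicHamiltonian H) (hl : IsPrimitive l)
    (hc : IsPositiveContact (hamForm H l)) : ∃ c > 0, ∀ s, ∀ z ∈ disc, c ≤ reebSpeed H l s z := by
  have hpos : ∀ s, ∀ z ∈ disc, 0 < reebSpeed H l s z := by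
    intro s z hz
    have := hc (s, z) ⟨mem_univ _, hz⟩
    rw [contactVol_hamForm hH hl s hz] at this
    linarith
  have hK : IsCompact (Icc 0 (2 * Real.pi) ×ˢ disc) :=
    isCompact_Icc.prod (isCompact_closedBall 0 1)
  have hne : (Icc 0 (2 * Real.pi) ×ˢ disc).Nonempty :=
    ⟨(0, 0), ⟨le_rfl, Real.two_pi_pos.le⟩, by simp [mem_disc]⟩
  obtain ⟨p, hp, hmin⟩ := hK.exists_isMinOn hne
    ((continuousOn_reebSpeed hH hl).mono (prod_mono (subset_univ _) subset_rfl))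
  refine ⟨reebSpeed H l p.1 p.2, hpos _ _ hp.2, fun s z hz => ?_⟩
  have hper : Function.Periodic (fun s => reebSpeed H l s z) (2 * Real.pi) := fun s => by
    simpa using hH.reebSpeed_add_int (l := l) s hz 1
  obtain ⟨s', hs', e⟩ := hper.exists_mem_Ico₀ Real.two_pi_pos s
  rw [e]
  exact hmin (⟨Ico_subset_Icc_self hs', hz⟩ : (s', z) ∈ Icc 0 (2 * Real.pi) ×ˢ disc)

/-- Reparametrisation of the line by a speed that is bounded below: `T = ∫ f` and its inverse. -/
theorem exists_time_change {f : ℝ → ℝ} (hf : Continuous f) {c : ℝ} (hc : 0 < c)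
    (h : ∀ s, c ≤ f s) : ∃ T σ : ℝ → ℝ, StrictMono T ∧ (∀ t, T (σ t) = t) ∧ (∀ s, σ (T s) = s) ∧
      ∀ t, HasDerivAt σ (f (σ t))⁻¹ t := by
  let T : ℝ → ℝ := fun s => ∫ x in (0 : ℝ)..s, f x
  have hT : ∀ s, HasDerivAt T (f s) s := fun s => (hf.integral_hasStrictDerivAt 0 s).hasDerivAt
  have hmono : StrictMono T := strictMono_of_deriv_pos fun s => by
    rw [(hT s).deriv]
    exact hc.trans_le (h s)
  have hcont : Continuous T := continuous_iff_continuousAt.2 fun s => (hT s).continuousAt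
  have hm2 : Monotone fun s => T s - c * s := by
    have hd : ∀ s, HasDerivAt (fun s => T s - c * s) (f s - c * 1) s := fun s =>
      (hT s).sub ((hasDerivAt_id s).const_mul c)
    refine monotone_of_deriv_nonneg (fun s => (hd s).differentiableAt) fun s => ?_
    rw [(hd s).deriv]
    linarith [h s]
  have hT0 : T 0 = 0 := intervalIntegral.integral_same
  have htop : Tendsto T atTop atTop := by
    refine tendsto_atTop_mono' _ ?_ (tendsto_id.const_mul_atTop hc)
    filter_upwards [eventually_ge_atTop 0] with s hs
    have := hm2 hs
    simp only [hT0, mul_zero, id] at this ⊢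
    linarith
  have hbot : Tendsto T atBot atBot := by
    refine tendsto_atBot_mono' _ ?_ (tendsto_id.const_mul_atBot hc)
    filter_upwards [eventually_le_atBot 0] with s hs
    have := hm2 hs
    simp only [hT0, mul_zero, id] at this ⊢
    linarith
  let e := hmono.orderIsoOfSurjective T (hcont.surjective htop hbot)
  refine ⟨T, e.symm, hmono, fun t => e.apply_symm_apply t, fun s => e.symm_apply_apply s, ?_⟩
  intro t
  exact HasDerivAt.of_local_left_inverse e.symm.continuous.continuousAt (hT _)
    (hc.trans_le (h _)).ne' (Eventually.of_forall fun t => e.apply_symm_apply t)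

/-! ### The contact form along the binding -/

theorem fderiv_apply_of_hasDerivAt {E F : Type*} [NormedAddCommGroup E] [NormedSpace ℝ E]
    [NormedAddCommGroup F] [NormedSpace ℝ F] {f : E → F} {x v : E} {w : F}
    (hf : DifferentiableAt ℝ f x) (h : HasDerivAt (fun t : ℝ => f (x + t • v)) w 0) :
    fderiv ℝ f x v = w :=
  HasDerivAt.unique (hf.hasFDerivAt.hasLineDerivAt v) h

theorem hasDerivAt_expI (a : ℝ) : HasDerivAt (fun t : ℝ => Complex.exp ((a + t : ℝ) * Complex.I))
    (Complex.exp (a * Complex.I) * Complex.I) 0 := by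
  have h1 : HasDerivAt (fun t : ℝ => ((a + t : ℝ) : ℂ) * Complex.I) Complex.I 0 := by
    simpa using ((hasDerivAt_id (0 : ℝ)).const_add a).ofReal_comp.mul_const Complex.I
  simpa using h1.cexp

namespace IsGluingPair

variable {h : ℕ} {δ : ℝ} {C : ℝ × ℂ → ℝ × ℂ →L[ℝ] ℝ}

theorem bind_apply_fst_of_ne_zero (hg : IsGluingPair h δ (hamForm H stdPrimitive) C) (b : ℝ) {w : ℂ}
    (hw : ‖w‖ < δ) (hw0 : w ≠ 0) : C (b, w) (1, 0) = (1 - ‖w‖ ^ 2) ^ 2 := by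
  have hρ := norm_pos_iff.2 hw0
  have hp : polar (b, ‖w‖, Complex.arg w) = (b, w) :=
    Prod.ext rfl (Complex.norm_mul_exp_arg_mul_I w)
  have hgl := congrArg (fun L : ℝ × ℝ × ℝ →L[ℝ] ℝ => L (1, 0, 0))
    (hg.glue b ‖w‖ (Complex.arg w) hρ hw)
  simp only [pull, ContinuousLinearMap.comp_apply, hp] at hgl
  have e1 : fderiv ℝ polar (b, ‖w‖, Complex.arg w) (1, 0, 0) = (1, 0) := by
    refine fderiv_apply_of_hasDerivAt (differentiable_polar _) ?_
    have : HasDerivAt (fun t : ℝ => (b + t, w)) ((1, 0) : ℝ × ℂ) 0 :=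
      ((hasDerivAt_id (0 : ℝ)).const_add b).prodMk (hasDerivAt_const _ _)
    refine this.congr_of_eventuallyEq (Eventually.of_forall fun t => ?_)
    refine Prod.ext (by simp [polar]) ?_
    simp [polar]
  have e2 : fderiv ℝ (bindingEmb h AreaDiffeo.refl) (b, ‖w‖, Complex.arg w) (1, 0, 0) =
      (0, ((1 - ‖w‖ ^ 2 : ℝ) : ℂ) * (Complex.exp ((b - h * Complex.arg w : ℝ) * Complex.I) *
        Complex.I)) := by
    refine fderiv_apply_of_hasDerivAt
      (differentiableAt_bindingEmb h _ hρ (hw.trans_le hg.le_one)) ?_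
    have := (hasDerivAt_const (0 : ℝ) (Complex.arg w)).prodMk
      ((hasDerivAt_expI (b - h * Complex.arg w)).const_mul ((1 - ‖w‖ ^ 2 : ℝ) : ℂ))
    refine this.congr_of_eventuallyEq (Eventually.of_forall fun t => ?_)
    refine Prod.ext (by simp [bindingEmb]) ?_
    simp only [bindingEmb, AreaDiffeo.refl, id, smul_eq_mul, mul_one, mul_zero, add_zero,
      Prod.mk_add_mk, Prod.smul_mk]
    congr 4
    ring
  rw [e1, e2] at hgl
  rw [hgl]
  simp only [hamForm, bindingEmb, AreaDiffeo.refl, id, add_apply, smul_apply,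
    ContinuousLinearMap.coe_fst', smul_eq_mul, mul_zero, zero_add, ContinuousLinearMap.comp_apply,
    ContinuousLinearMap.coe_snd', stdPrimitive, sub_apply, Complex.imCLM_apply,
    Complex.reCLM_apply, Complex.mul_re, Complex.mul_im, Complex.ofReal_re, Complex.ofReal_im,
    Complex.exp_ofReal_mul_I_re, Complex.exp_ofReal_mul_I_im, Complex.I_re, Complex.I_im]
  have := Real.sin_sq_add_cos_sq (b - h * Complex.arg w)
  linear_combination (1 - ‖w‖ ^ 2) ^ 2 * this

theorem bind_apply_radial_of_ne_zero (hg : IsGluingPair h δ (hamForm H stdPrimitive) C) (b : ℝ)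
    {w : ℂ} (hw : ‖w‖ < δ) (hw0 : w ≠ 0) : C (b, w) (0, w) = 0 := by
  have hρ := norm_pos_iff.2 hw0
  have hp : polar (b, ‖w‖, Complex.arg w) = (b, w) :=
    Prod.ext rfl (Complex.norm_mul_exp_arg_mul_I w)
  have hgl := congrArg (fun L : ℝ × ℝ × ℝ →L[ℝ] ℝ => L (0, ‖w‖, 0))
    (hg.glue b ‖w‖ (Complex.arg w) hρ hw)
  simp only [pull, ContinuousLinearMap.comp_apply, hp] at hgl
  have e1 : fderiv ℝ polar (b, ‖w‖, Complex.arg w) (0, ‖w‖, 0) = (0, w) := by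
    refine fderiv_apply_of_hasDerivAt (differentiable_polar _) ?_
    have h1 : HasDerivAt (fun t : ℝ => w + (t : ℂ) * w) w 0 := by
      simpa using (((hasDerivAt_id (0 : ℝ)).ofReal_comp.mul_const w).const_add w)
    have := (hasDerivAt_const (0 : ℝ) b).prodMk h1
    refine this.congr_of_eventuallyEq (Eventually.of_forall fun t => ?_)
    refine Prod.ext (by simp [polar]) ?_
    simp [polar]
    linear_combination (1 + (t : ℂ)) * Complex.norm_mul_exp_arg_mul_I w
  have e2 : ∃ r : ℝ, fderiv ℝ (bindingEmb h AreaDiffeo.refl) (b, ‖w‖, Complex.arg w) (0, ‖w‖, 0) =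
      (0, (r : ℂ) * Complex.exp ((b - h * Complex.arg w : ℝ) * Complex.I)) := by
    have h1 : HasDerivAt (fun t : ℝ => 1 - (‖w‖ + t * ‖w‖) ^ 2)
        (-(2 * (‖w‖ + 0 * ‖w‖) * ‖w‖)) 0 := by
      simpa using ((((hasDerivAt_id (0 : ℝ)).mul_const ‖w‖).const_add ‖w‖).pow 2).const_sub 1
    refine ⟨-(2 * (‖w‖ + 0 * ‖w‖) * ‖w‖), fderiv_apply_of_hasDerivAt
      (differentiableAt_bindingEmb h _ hρ (hw.trans_le hg.le_one)) ?_⟩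
    have := (hasDerivAt_const (0 : ℝ) (Complex.arg w)).prodMk
      (h1.ofReal_comp.mul_const (Complex.exp ((b - h * Complex.arg w : ℝ) * Complex.I)))
    refine this.congr_of_eventuallyEq (Eventually.of_forall fun t => ?_)
    refine Prod.ext (by simp [bindingEmb]) ?_
    simp [bindingEmb, AreaDiffeo.refl]
  obtain ⟨r, e2⟩ := e2
  rw [e1, e2] at hgl
  rw [hgl]
  simp only [hamForm, bindingEmb, AreaDiffeo.refl, id, add_apply, smul_apply,
    ContinuousLinearMap.coe_fst', smul_eq_mul, mul_zero, zero_add, ContinuousLinearMap.comp_apply,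
    ContinuousLinearMap.coe_snd', stdPrimitive, sub_apply, Complex.imCLM_apply,
    Complex.reCLM_apply, Complex.mul_re, Complex.mul_im, Complex.ofReal_re, Complex.ofReal_im,
    Complex.exp_ofReal_mul_I_re, Complex.exp_ofReal_mul_I_im]
  ring

/-- Along the binding `C` is `db`. -/
theorem bind_apply_binding (hg : IsGluingPair h δ (hamForm H stdPrimitive) C) (hδ : 0 < δ) (b : ℝ)
    (v : ℝ × ℂ) : C (b, 0) v = v.1 := by
  have hcont : ∀ u : ℂ, Tendsto (fun t : ℝ => C (b, (t : ℂ) * u)) (𝓝[≠] 0) (𝓝 (C (b, 0))) := by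
    intro u
    have h1 : ContinuousAt C (b, ((0 : ℝ) : ℂ) * u) := by
      simpa using (hg.contDiffAt_bind (p := (b, 0)) (by simpa using hδ)).continuousAt
    have h2 : ContinuousAt (fun t : ℝ => (b, (t : ℂ) * u)) 0 := by fun_prop
    have h3 := ContinuousAt.comp (f := fun t : ℝ => (b, (t : ℂ) * u)) (x := 0) h1 h2
    simpa [Function.comp_def] using h3.tendsto.mono_left nhdsWithin_le_nhds
  have hsmall : ∀ u : ℂ, ∀ᶠ t : ℝ in 𝓝[≠] 0, ‖(t : ℂ) * u‖ < δ ∧ t ≠ 0 := by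
    intro u
    have h2 : ContinuousAt (fun t : ℝ => ‖(t : ℂ) * u‖) 0 := by fun_prop
    exact ((h2.eventually_lt continuousAt_const (by simpa using hδ)).filter_mono
      nhdsWithin_le_nhds).and self_mem_nhdsWithin
  have hfst : C (b, 0) (1, 0) = 1 := by
    have h1 := ((ContinuousLinearMap.apply ℝ ℝ ((1, 0) : ℝ × ℂ)).continuous.tendsto _).comp
      (hcont 1)
    have h2 : Tendsto (fun t : ℝ => (1 - ‖(t : ℂ) * 1‖ ^ 2) ^ 2) (𝓝[≠] 0) (𝓝 1) := by
      have : ContinuousAt (fun t : ℝ => (1 - ‖(t : ℂ) * 1‖ ^ 2) ^ 2) 0 := by fun_prop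
      simpa [ContinuousAt] using this.tendsto.mono_left nhdsWithin_le_nhds
    refine tendsto_nhds_unique (h1.congr' ?_) h2
    filter_upwards [hsmall 1] with t ht
    exact hg.bind_apply_fst_of_ne_zero b ht.1 (by simpa using ht.2)
  have hsnd : ∀ u : ℂ, C (b, 0) (0, u) = 0 := by
    intro u
    by_cases hu : u = 0
    · rw [hu, show ((0, 0) : ℝ × ℂ) = 0 from rfl, map_zero]
    have h1 := ((ContinuousLinearMap.apply ℝ ℝ ((0, u) : ℝ × ℂ)).continuous.tendsto _).comp
      (hcont u)
    refine tendsto_nhds_unique (h1.congr' ?_) tendsto_const_nhds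
    filter_upwards [hsmall u] with t ht
    have h2 := hg.bind_apply_radial_of_ne_zero b ht.1 (mul_ne_zero (by simpa using ht.2) hu)
    rw [show ((0, (t : ℂ) * u) : ℝ × ℂ) = t • (0, u) by simp, map_smul, smul_eq_mul] at h2
    exact (mul_eq_zero.1 h2).resolve_left ht.2
  have hv : v = v.1 • ((1, 0) : ℝ × ℂ) + (0, v.2) := by ext <;> simp
  rw [hv, map_add, map_smul, hfst, hsnd]
  simp

theorem bind_apply_fst (hg : IsGluingPair h δ (hamForm H stdPrimitive) C) (hδ : 0 < δ) (b : ℝ)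
    {w : ℂ} (hw : ‖w‖ < δ) : C (b, w) (1, 0) = (1 - ‖w‖ ^ 2) ^ 2 := by
  by_cases h0 : w = 0
  · rw [h0, hg.bind_apply_binding hδ]
    simp
  · exact hg.bind_apply_fst_of_ne_zero b hw h0

/-- The direction `∂_b` of the binding is in the kernel of `dC`, since `C(∂_b) = (1 - ρ²)²` is
critical along the binding. -/
theorem extd_bind_binding (hg : IsGluingPair h δ (hamForm H stdPrimitive) C) (hδ : 0 < δ) (b : ℝ)
    (v : ℝ × ℂ) : extd univ C (b, 0) (1, 0) v = 0 := by
  have hb : ‖((b, 0) : ℝ × ℂ).2‖ < δ := by simpa using hδ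
  have hd : DifferentiableAt ℝ C (b, 0) := (hg.contDiffAt_bind hb).differentiableAt (by simp)
  have h1 : fderiv ℝ C (b, 0) (1, 0) v = 0 := by
    have h2 : HasDerivAt (fun t : ℝ => C ((b, 0) + t • (1, 0))) (fderiv ℝ C (b, 0) (1, 0)) 0 :=
      hd.hasFDerivAt.hasLineDerivAt _
    have h3 := h2.clm_apply (hasDerivAt_const (0 : ℝ) v)
    have h4 : (fun t : ℝ => C ((b, 0) + t • (1, 0)) v) = fun _ => v.1 := by
      funext t
      have : ((b, 0) : ℝ × ℂ) + t • (1, 0) = (b + t, 0) := by simp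
      rw [this, hg.bind_apply_binding hδ]
    rw [h4] at h3
    simpa using h3.unique (hasDerivAt_const (0 : ℝ) v.1)
  have h2 : fderiv ℝ C (b, 0) v (1, 0) = 0 := by
    have h3 := hd.hasFDerivAt.clm_apply (hasFDerivAt_const ((1, 0) : ℝ × ℂ) ((b, 0) : ℝ × ℂ))
    have h4 : (fun p => C p (1, 0)) =ᶠ[𝓝 (b, 0)] fun p => (1 - ‖p.2‖ ^ 2) ^ 2 := by
      have : ContinuousAt (fun p : ℝ × ℂ => ‖p.2‖) (b, 0) := by fun_prop
      filter_upwards [this.eventually_lt continuousAt_const hb] with p hp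
      exact hg.bind_apply_fst hδ p.1 hp
    have h5 := (((hasFDerivAt_snd (𝕜 := ℝ) (p := ((b, 0) : ℝ × ℂ))).norm_sq).const_sub 1).pow 2
    have h6 := congrArg (fun L : ℝ × ℂ →L[ℝ] ℝ => L v)
      (h3.unique (h5.congr_of_eventuallyEq h4))
    simpa using h6
  rw [extd, fderivWithin_univ, h1, h2, sub_zero]

end IsGluingPair

end ReebDirection

/-! ### The Reeb flow on the sphere -/

/-- The Reeb vector field on `S³`: rotation along the binding `{0} × S¹`, and off the binding the
image of the multiple of `∂_s + X_s` on which the contact form is one. The jump of the chart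
`cutChart h 0` along its branch cut is invisible, as everything is `2π`-periodic in `s`. -/
def reebField (h : ℕ) (H : ℝ → ℂ → ℝ) (l : ℂ → ℂ →L[ℝ] ℝ) (p : ℂ × ℂ) : ℂ × ℂ :=
  open Classical in
  if p.1 = 0 then (0, Complex.I * p.2)
  else fderiv ℝ (cutMap h) (cutChart h 0 p) ((reebSpeed H l (cutChart h 0 p).1
    (cutChart h 0 p).2)⁻¹ • (1, hamVec H (cutChart h 0 p).1 (cutChart h 0 p).2))

theorem cutMap_fst_ne_zero (h : ℕ) {p : ℝ × ℂ} (hp : p.2 ∈ openDisc) : (cutMap h p).1 ≠ 0 :=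
  (cutMap_fst_inSector h hp).ne_zero

theorem fderiv_cutMap_add_period (h : ℕ) (s : ℝ) (n : ℤ) (z : ℂ) :
    fderiv ℝ (cutMap h) (s + n * (2 * Real.pi), z) = fderiv ℝ (cutMap h) (s, z) := by
  have h1 := fderiv_comp_add_right (𝕜 := ℝ) (f := cutMap h) (x := (s, z))
    ((n * (2 * Real.pi) : ℝ), (0 : ℂ))
  have h2 : (fun p : ℝ × ℂ => cutMap h (p + ((n * (2 * Real.pi) : ℝ), (0 : ℂ)))) = cutMap h := by
    funext p
    rw [← cutMap_add_period h p.1 n p.2]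
    congr 1
    ext <;> simp
  rw [h2] at h1
  rw [h1]
  simp

theorem reebField_cutMap (h : ℕ) {H : ℝ → ℂ → ℝ} (hH : IsPeriodicHamiltonian H)
    (l : ℂ → ℂ →L[ℝ] ℝ) (s : ℝ) {z : ℂ} (hz : z ∈ openDisc) :
    reebField h H l (cutMap h (s, z)) =
      fderiv ℝ (cutMap h) (s, z) ((reebSpeed H l s z)⁻¹ • (1, hamVec H s z)) := by
  have hzd := openDisc_subset_disc hz
  have hne := cutMap_fst_ne_zero h (p := (s, z)) hz
  have hx := cutMap_cutChart h 0 hne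
  have hxm := cutChart_mem_openDisc h 0 hne
  rw [rad_of_mem_sphere3 (cutMap_mem_sphere3 h hzd)] at hx
  rw [reebField, if_neg hne]
  generalize cutChart h 0 (cutMap h (s, z)) = x at hx hxm
  obtain ⟨s', z'⟩ := x
  have hxd := openDisc_subset_disc hxm
  rcases (cutMap_eq_iff h _ _ hxd hzd).1 hx with ⟨rfl, n, rfl⟩ | ⟨hc, -, -⟩
  · rw [fderiv_cutMap_add_period, hH.reebSpeed_add_int _ hzd, hH.hamVec_add_int _ hzd]
  · exact absurd hxm ((mem_circ_iff hxd).1 hc)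

theorem eventually_cutMap_mem_sphere3 (h : ℕ) {p : ℝ × ℂ} (hp : p.2 ∈ openDisc) :
    ∀ᶠ q in 𝓝 p, cutMap h q ∈ sphere3 := by
  filter_upwards [isOpen_openTorus.mem_nhds (show p ∈ openTorus from ⟨mem_univ _, hp⟩)] with q hq
  exact cutMap_mem_sphere3 h (openDisc_subset_disc hq.2)

theorem exists_cutMap_eq (h : ℕ) {p : ℂ × ℂ} (hp : p ∈ sphere3) (hp1 : p.1 ≠ 0) :
    ∃ s, ∃ z ∈ openDisc, cutMap h (s, z) = p :=
  ⟨_, _, cutChart_mem_openDisc h 0 hp1, by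
    rw [Prod.mk.eta, cutMap_cutChart h 0 hp1, rad_of_mem_sphere3 hp]⟩

theorem fderiv_bindMap_binding (b : ℝ) :
    fderiv ℝ bindMap (b, 0) (1, 0) = (0, Complex.I * (bindMap (b, 0)).2) := by
  refine fderiv_apply_of_hasDerivAt ((contDiffAt_bindMap (by simp)).differentiableAt
    (n := ∞) (by simp)) ?_
  have h1 := (hasDerivAt_const (0 : ℝ) (0 : ℂ)).prodMk (hasDerivAt_expI b)
  have h2 : Complex.I * (bindMap (b, 0)).2 = Complex.exp (b * Complex.I) * Complex.I := by
    simp [bindMap, mul_comm]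
  rw [h2]
  refine h1.congr_of_eventuallyEq (Eventually.of_forall fun t => ?_)
  simp [bindMap]

theorem isReebField {h : ℕ} {H : ℝ → ℂ → ℝ} {ψ : AreaDiffeo}
    (hψ : EmbedsByCut h H stdPrimitive AreaDiffeo.refl ψ) {δ : ℝ} {C : ℝ × ℂ → ℝ × ℂ →L[ℝ] ℝ}
    (hδ : 0 < δ) (hg : IsGluingPair h δ (hamForm H stdPrimitive) C) :
    IsReebField (sphereForm h (hamForm H stdPrimitive) C) (reebField h H stdPrimitive) := by
  intro p hp
  have hp0 := ne_zero_of_mem_sphere3 hp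
  rw [extd_of_mem_nhds (isOpen_compl_singleton.mem_nhds hp0)]
  by_cases hp1 : p.1 = 0
  · have hp2 : p.2 ≠ 0 := fun h2 => hp0 (Prod.ext hp1 h2)
    -- The point is `bindMap (b, 0)`, and the Reeb direction is the image of `∂_b`.
    obtain ⟨b, rfl⟩ : ∃ b, bindMap (b, 0) = p := by
      refine ⟨(bindChart 0 p).1, ?_⟩
      have := bindMap_bindChart 0 hp0
      rwa [rad_of_mem_sphere3 hp, ← Prod.mk.eta (p := bindChart 0 p),
        bindChart_snd_eq_zero hp1] at this
    have hw : ‖((b, 0) : ℝ × ℂ).2‖ < 1 := by simp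
    have hc := bindMap_snd_inSector hw
    have hd := (contDiffAt_bindMap hw).differentiableAt (n := ∞) (by simp)
    have hd2 := contDiffAt_bindChart hc
    have hev := bindChart_bindMap_eventually hw
    have hb : bindChart b (bindMap (b, 0)) = (b, 0) := hev.self_of_nhds
    have hbδ : ‖(bindChart b (bindMap (b, 0))).2‖ < δ := by simpa [hb] using hδ
    have hinv := fderiv_comp_apply_of_leftInverse hd (hd2.differentiableAt (by simp)) hev
    rw [reebField, if_pos hp1, ← fderiv_bindMap_binding]
    refine ⟨?_, ?_, ?_⟩
    · refine isTangent_fderiv hd ?_ _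
      have : ContinuousAt (fun q : ℝ × ℂ => ‖q.2‖) (b, 0) := by fun_prop
      filter_upwards [this.eventually_lt continuousAt_const hw] with q hq
      exact bindMap_mem_sphere3 hq
    · rw [hg.sphereForm_eq_bind hc hbδ, pull, ContinuousLinearMap.comp_apply, hinv, hb,
        hg.bind_apply_binding hδ]
    · intro v _
      rw [extd_congr_of_eventuallyEq (hg.sphereForm_eventuallyEq_bind hc hbδ),
        extd_pull hd2 ((hg.contDiffAt_bind hbδ).differentiableAt (by simp)), hinv, hb,
        hg.extd_bind_binding hδ]
  · obtain ⟨s, z, hz, rfl⟩ := exists_cutMap_eq h hp hp1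
    have hzd := openDisc_subset_disc hz
    have hc := cutMap_fst_inSector h (p := (s, z)) hz
    have hd := (contDiffAt_cutMap h (p := (s, z)) hz).differentiableAt (n := ∞) (by simp)
    have hd2 := contDiffAt_cutChart h hc
    have hev := cutChart_cutMap_eventually h (p := (s, z)) hz
    have hx : cutChart h s (cutMap h (s, z)) = (s, z) := hev.self_of_nhds
    have hinv := fderiv_comp_apply_of_leftInverse hd (hd2.differentiableAt (by simp)) hev
    have hpos : 0 < reebSpeed H stdPrimitive s z := by
      obtain ⟨c, h0, hle⟩ := exists_le_reebSpeed hψ.hamiltonian hψ.primitive hψ.contact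
      exact h0.trans_le (hle s z hzd)
    rw [reebField_cutMap h hψ.hamiltonian _ s hz]
    refine ⟨isTangent_fderiv hd (eventually_cutMap_mem_sphere3 h hz) _, ?_, ?_⟩
    · rw [hg.sphereForm_eq_cut hc, pull, ContinuousLinearMap.comp_apply, hinv, hx, map_smul,
        smul_eq_mul]
      have : hamForm H stdPrimitive (s, z) (1, hamVec H s z) = reebSpeed H stdPrimitive s z := by
        simp [hamForm, reebSpeed]
      rw [this, inv_mul_cancel₀ hpos.ne']
    · intro v _
      have hm : (cutChart h s (cutMap h (s, z))).2 ∈ openDisc := by rwa [hx]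
      have hker := extd_hamForm_hamVec hψ.hamiltonian hψ.primitive s hzd
        (fderiv ℝ (cutChart h s) (cutMap h (s, z)) v)
      rw [extd_of_mem_nhds (solidTorus_mem_nhds hz)] at hker
      rw [extd_congr_of_eventuallyEq (hg.sphereForm_eventuallyEq_cut hc),
        extd_pull hd2 ((hg.contDiffAt hm).differentiableAt (by simp)), hinv, hx]
      simp only [extd, map_smul, smul_apply, smul_eq_mul] at hker ⊢
      rw [← mul_sub, hker, mul_zero]

/-- The Reeb flow: off the binding, the orbits are the reparametrised curves
`s ↦ cutMap (s, F_s a)`, where `F` is the Hamiltonian isotopy. The time at which the orbit of `a`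
reaches the angle `s` is `T a s`, up to a constant, and `σ a` is inverse to `T a`. -/
theorem exists_flow {h : ℕ} {H : ℝ → ℂ → ℝ} {ψ : AreaDiffeo}
    (hψ : EmbedsByCut h H stdPrimitive AreaDiffeo.refl ψ) :
    ∃ Fl : ℝ → ℂ × ℂ → ℂ × ℂ, IsFlowOf (reebField h H stdPrimitive) Fl ∧
      (∀ w t, Fl t (0, w) = (0, Complex.exp (t * Complex.I) * w)) ∧
      ∃ F : ℝ → AreaDiffeo, (∀ z ∈ disc, F (2 * Real.pi) z = ψ z) ∧
        ∃ T σ : ℂ → ℝ → ℝ, (∀ a ∈ disc, StrictMono (T a) ∧ (∀ t, T a (σ a t) = t) ∧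
          ∀ s, σ a (T a s) = s) ∧
        (∀ p ∈ sphere3, p.1 ≠ 0 → ∃ s, ∃ a ∈ openDisc, ∀ t,
          Fl t p = cutMap h (σ a (T a s + t), F (σ a (T a s + t)) a)) ∧
        ∀ a ∈ openDisc, ∀ t,
          Fl t (cutMap h (0, a)) = cutMap h (σ a (T a 0 + t), F (σ a (T a 0 + t)) a) := by
  obtain ⟨F, hF, hF0, hF1, hX⟩ := hψ.generates
  have hd : ∀ s, ∀ z ∈ disc, HasDerivAt (fun t => F t z) (hamVec H s (F s z)) s := by
    intro s z hz
    obtain ⟨X, h1, h2⟩ := hX s z hz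
    rwa [← eq_hamVec h2]
  obtain ⟨c, hc, hle⟩ := exists_le_reebSpeed hψ.hamiltonian hψ.primitive hψ.contact
  have htc : ∀ a : ℂ, ∃ T σ : ℝ → ℝ, a ∈ disc → StrictMono T ∧ (∀ t, T (σ t) = t) ∧
      (∀ s, σ (T s) = s) ∧
      ∀ t, HasDerivAt σ (reebSpeed H stdPrimitive (σ t) (F (σ t) a))⁻¹ t := by
    intro a
    by_cases ha : a ∈ disc
    · have hcurve : Continuous fun s => ((s, F s a) : ℝ × ℂ) :=
        continuous_id.prodMk (continuous_iff_continuousAt.2 fun s => (hd s a ha).continuousAt)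
      have hcont : Continuous fun s => reebSpeed H stdPrimitive s (F s a) :=
        (continuousOn_reebSpeed hψ.hamiltonian hψ.primitive).comp_continuous hcurve
          fun s => ⟨mem_univ _, (F s).mapsTo ha⟩
      obtain ⟨T, σ, h1, h2, h3, h4⟩ := exists_time_change hcont hc
        fun s => hle s _ ((F s).mapsTo ha)
      exact ⟨T, σ, fun _ => ⟨h1, h2, h3, h4⟩⟩
    · exact ⟨id, id, fun h => absurd h ha⟩
  choose T σ hTσ using htc
  let a₀ : ℂ × ℂ → ℂ := fun p => (F (cutChart h 0 p).1).invFun (cutChart h 0 p).2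
  have ha₀ : ∀ p : ℂ × ℂ, p.1 ≠ 0 → a₀ p ∈ openDisc := fun p hp =>
    (F _).mapsTo_inv_openDisc (cutChart_mem_openDisc h 0 hp)
  classical
  let Fl : ℝ → ℂ × ℂ → ℂ × ℂ := fun t p =>
    if p.1 = 0 then (0, Complex.exp (t * Complex.I) * p.2)
    else cutMap h (σ (a₀ p) (T (a₀ p) (cutChart h 0 p).1 + t),
      F (σ (a₀ p) (T (a₀ p) (cutChart h 0 p).1 + t)) (a₀ p))
  have hFl1 : ∀ p : ℂ × ℂ, p.1 ≠ 0 → ∀ t, Fl t p =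
      cutMap h (σ (a₀ p) (T (a₀ p) (cutChart h 0 p).1 + t),
        F (σ (a₀ p) (T (a₀ p) (cutChart h 0 p).1 + t)) (a₀ p)) := fun p hp t => if_neg hp
  have hFl0 : ∀ p : ℂ × ℂ, p.1 = 0 → ∀ t, Fl t p = (0, Complex.exp (t * Complex.I) * p.2) :=
    fun p hp t => if_pos hp
  refine ⟨Fl, ?_, fun w t => hFl0 _ rfl t, F, hF1, T, σ, ?_, ?_, ?_⟩
  · intro p hp
    by_cases hp1 : p.1 = 0
    · refine ⟨?_, fun t => ⟨?_, ?_⟩⟩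
      · rw [hFl0 p hp1]
        exact Prod.ext hp1.symm (by simp)
      · rw [hFl0 p hp1]
        have := norm_snd_eq_one_of_mem_sphere3 hp hp1
        simp [sphere3, Complex.norm_exp_ofReal_mul_I, this]
      · rw [hFl0 p hp1 t, reebField, if_pos rfl]
        have h1 : HasDerivAt (fun t : ℝ => (t : ℂ) * Complex.I) Complex.I t := by
          simpa using (hasDerivAt_id t).ofReal_comp.mul_const Complex.I
        have h2 := (hasDerivAt_const t (0 : ℂ)).prodMk (h1.cexp.mul_const p.2)
        have h3 : Complex.I * (Complex.exp (t * Complex.I) * p.2) =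
          Complex.exp (t * Complex.I) * Complex.I * p.2 := by ring
        simp only [h3]
        exact h2.congr_of_eventuallyEq (Eventually.of_forall fun τ => hFl0 p hp1 τ)
    · have ha := ha₀ p hp1
      have had := openDisc_subset_disc ha
      obtain ⟨-, -, hinv, hder⟩ := hTσ _ had
      refine ⟨?_, fun t => ⟨?_, ?_⟩⟩
      · rw [hFl1 p hp1, add_zero, hinv]
        have h1 := (F (cutChart h 0 p).1).right_inv _
          (openDisc_subset_disc (cutChart_mem_openDisc h 0 hp1))
        rw [show F (cutChart h 0 p).1 (a₀ p) = (cutChart h 0 p).2 from h1, Prod.mk.eta,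
          cutMap_cutChart h 0 hp1, rad_of_mem_sphere3 hp]
      · rw [hFl1 p hp1]
        exact cutMap_mem_sphere3 h ((F _).mapsTo had)
      · have hm := (F (σ (a₀ p) (T (a₀ p) (cutChart h 0 p).1 + t))).mapsTo_openDisc ha
        rw [hFl1 p hp1 t, reebField_cutMap h hψ.hamiltonian _ _ hm]
        have h1 : HasDerivAt (fun τ => σ (a₀ p) (T (a₀ p) (cutChart h 0 p).1 + τ)) _ t :=
          HasDerivAt.comp_const_add _ t (hder _)
        have h2 := h1.prodMk ((hd _ _ had).scomp t h1)
        have h3 := ((contDiffAt_cutMap h (p := (_, _)) hm).differentiableAt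
          (n := ∞) (by simp)).hasFDerivAt.comp_hasDerivAt t h2
        have h4 := h3.congr_of_eventuallyEq (Eventually.of_forall fun τ => hFl1 p hp1 τ)
        rw [Prod.smul_mk, smul_eq_mul, mul_one]
        exact h4
  · intro a ha
    obtain ⟨h1, h2, h3, -⟩ := hTσ a ha
    exact ⟨h1, h2, h3⟩
  · intro p _ hp1
    exact ⟨_, _, ha₀ p hp1, hFl1 p hp1⟩
  · intro a ha t
    have h1 : cutChart h 0 (cutMap h (0, a)) = (0, a) :=
      cutChart_cutMap h ha (by simpa using Real.pi_pos)
    have h2 : a₀ (cutMap h (0, a)) = a := by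
      have had := openDisc_subset_disc ha
      have h3 := (F 0).left_inv a had
      rw [hF0 a had] at h3
      change (F (cutChart h 0 (cutMap h (0, a))).1).invFun (cutChart h 0 (cutMap h (0, a))).2 = a
      rw [h1]
      exact h3
    rw [hFl1 _ (cutMap_fst_ne_zero h ha), h2, h1]

/-! ### The page of the open book -/

/-- A smooth embedding of the closed disc onto the hemisphere `cutMap h (0, D²)`, smooth up to the
boundary: inverse stereographic projection. -/
def hemisphere (z : ℂ) : ℂ × ℂ :=
  (((1 - ‖z‖ ^ 2) / (1 + ‖z‖ ^ 2) : ℝ), (2 / (1 + ‖z‖ ^ 2) : ℝ) • z)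

theorem contDiff_hemisphere : ContDiff ℝ ∞ hemisphere := by
  have h1 : ContDiff ℝ ∞ fun z : ℂ => ‖z‖ ^ 2 := contDiff_id.norm_sq ℝ
  have h2 : ∀ z : ℂ, 1 + ‖z‖ ^ 2 ≠ 0 := fun z => by positivity
  exact (ofReal_contDiff.comp ((contDiff_const.sub h1).div (contDiff_const.add h1) h2)).prodMk
    ((contDiff_const.div (contDiff_const.add h1) h2).smul contDiff_id)

theorem hemisphere_leftInverse (z : ℂ) :
    (1 + (hemisphere z).1.re)⁻¹ • (hemisphere z).2 = z := by
  have h2 : 0 < 1 + ‖z‖ ^ 2 := by positivity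
  simp only [hemisphere, Complex.ofReal_re, smul_smul]
  have : (1 + (1 - ‖z‖ ^ 2) / (1 + ‖z‖ ^ 2))⁻¹ * (2 / (1 + ‖z‖ ^ 2)) = 1 := by
    have h3 : 1 + (1 - ‖z‖ ^ 2) / (1 + ‖z‖ ^ 2) = 2 / (1 + ‖z‖ ^ 2) := by
      field_simp
      ring
    rw [h3, inv_mul_cancel₀ (by positivity)]
  rw [this, one_smul]

theorem fderiv_hemisphere_injective (z : ℂ) : Function.Injective (fderiv ℝ hemisphere z) := by
  refine fderiv_injective_of_leftInverse (g := fun p : ℂ × ℂ => (1 + p.1.re)⁻¹ • p.2)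
    (contDiff_hemisphere.differentiable (by simp) z) ?_
    (Eventually.of_forall hemisphere_leftInverse)
  have h2 : 1 + (hemisphere z).1.re ≠ 0 := by
    have h3 : 1 + (1 - ‖z‖ ^ 2) / (1 + ‖z‖ ^ 2) = 2 / (1 + ‖z‖ ^ 2) := by
      field_simp
      ring
    simp only [hemisphere, Complex.ofReal_re, h3]
    positivity
  have h4 : DifferentiableAt ℝ (fun p : ℂ × ℂ => 1 + p.1.re) (hemisphere z) := by
    have e : ∀ w : ℂ, w.re = Complex.reCLM w := fun _ => rfl
    simp only [e]
    fun_prop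
  exact (h4.inv h2).smul differentiableAt_snd

theorem cutMap_zero (h : ℕ) (z : ℂ) : cutMap h (0, z) = (((√(1 - ‖z‖ ^ 2) : ℝ) : ℂ), z) := by
  simp [cutMap]

theorem hemisphere_eq_cutMap (h : ℕ) {z : ℂ} (hz : z ∈ disc) :
    hemisphere z = cutMap h (0, (2 / (1 + ‖z‖ ^ 2) : ℝ) • z) := by
  have h2 : 0 < 1 + ‖z‖ ^ 2 := by positivity
  have h3 : 0 ≤ 1 - ‖z‖ ^ 2 := by nlinarith [mem_disc.1 hz, norm_nonneg z]
  rw [cutMap_zero, hemisphere, norm_smul, Real.norm_eq_abs, abs_of_pos (by positivity)]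
  have : 1 - (2 / (1 + ‖z‖ ^ 2) * ‖z‖) ^ 2 = ((1 - ‖z‖ ^ 2) / (1 + ‖z‖ ^ 2)) ^ 2 := by
    field_simp
    ring
  rw [this, Real.sqrt_sq (by positivity)]

theorem cutMap_zero_eq_hemisphere (h : ℕ) {w : ℂ} (hw : w ∈ disc) :
    ∃ z ∈ disc, hemisphere z = cutMap h (0, w) := by
  have h0 : 0 ≤ 1 - ‖w‖ ^ 2 := by nlinarith [mem_disc.1 hw, norm_nonneg w]
  have hc := Real.sqrt_nonneg (1 - ‖w‖ ^ 2)
  have hc2 := Real.sq_sqrt h0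
  rw [cutMap_zero]
  generalize √(1 - ‖w‖ ^ 2) = c at hc hc2
  have h1 : 0 < 1 + c := by positivity
  have hn : ‖(1 + c)⁻¹ • w‖ ^ 2 = (1 - c) / (1 + c) := by
    rw [norm_smul, Real.norm_eq_abs, abs_of_pos (inv_pos.2 h1), mul_pow,
      show ‖w‖ ^ 2 = (1 - c) * (1 + c) by linarith]
    field_simp
  refine ⟨(1 + c)⁻¹ • w, ?_, ?_⟩
  · rw [mem_disc, ← sq_le_one_iff₀ (norm_nonneg _), hn, div_le_one h1]
    linarith
  · rw [hemisphere, hn, smul_smul]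
    have e1 : 1 + (1 - c) / (1 + c) = 2 / (1 + c) := by
      field_simp
      ring
    have e2 : (1 - (1 - c) / (1 + c)) / (2 / (1 + c)) = c := by
      field_simp
      ring
    have e3 : 2 / (2 / (1 + c)) * (1 + c)⁻¹ = 1 := by
      field_simp
    rw [e1, e2, e3, one_smul]

theorem hemisphere_image_disc (h : ℕ) :
    hemisphere '' disc = (fun z => cutMap h (0, z)) '' disc := by
  refine Subset.antisymm ?_ ?_
  · rintro _ ⟨z, hz, rfl⟩
    refine ⟨_, ?_, (hemisphere_eq_cutMap h hz).symm⟩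
    rw [mem_disc, norm_smul, Real.norm_eq_abs, abs_of_pos (by positivity), div_mul_eq_mul_div,
      div_le_one (by positivity)]
    nlinarith [sq_nonneg (1 - ‖z‖)]
  · rintro _ ⟨w, hw, rfl⟩
    obtain ⟨z, hz, e⟩ := cutMap_zero_eq_hemisphere h hw
    exact ⟨z, hz, e⟩

theorem hemisphere_image_circ (h : ℕ) :
    hemisphere '' circ = (fun z => cutMap h (0, z)) '' circ := by
  refine image_congr fun z hz => ?_
  rw [hemisphere_eq_cutMap h (circ_subset_disc hz), mem_circ.1 hz]
  norm_num

theorem cutMap_zero_image_circ (h : ℕ) :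
    (fun z => cutMap h (0, z)) '' circ = {p | p.1 = 0 ∧ ‖p.2‖ = 1} := by
  ext p
  constructor
  · rintro ⟨z, hz, rfl⟩
    have := mem_circ.1 hz
    simp [cutMap_zero, this]
  · rintro ⟨h1, h2⟩
    exact ⟨p.2, mem_circ.2 h2, by
      change cutMap h (0, p.2) = p
      rw [cutMap_zero, h2]
      exact Prod.ext (by simp [h1]) rfl⟩

/-- The parametrisation of the page over `s = 0` by a disc map. -/
def page (h : ℕ) (f : AreaDiffeo) (z : ℂ) : ℂ × ℂ := cutMap h (0, f z)

theorem page_image (h : ℕ) (f : AreaDiffeo) {S : Set ℂ} (hS : f '' S = S) :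
    page h f '' S = (fun z => cutMap h (0, z)) '' S := by
  conv_rhs => rw [← hS, image_image]
  rfl

theorem page_image_circ (h : ℕ) (f : AreaDiffeo) :
    page h f '' circ = {p | p.1 = 0 ∧ ‖p.2‖ = 1} := by
  rw [page_image h f f.image_circ, cutMap_zero_image_circ]

theorem contDiffAt_page (h : ℕ) (f : AreaDiffeo) {z : ℂ} (hz : z ∈ openDisc) :
    ContDiffAt ℝ ∞ (page h f) z :=
  (contDiffAt_cutMap h (p := (0, f z)) (f.mapsTo_openDisc hz)).comp z
    (contDiffAt_const.prodMk (f.contDiffAt hz))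

theorem fderiv_page (h : ℕ) (f : AreaDiffeo) {z : ℂ} (hz : z ∈ openDisc) (v : ℂ) :
    fderiv ℝ (page h f) z v =
      fderiv ℝ (cutMap h) (0, f z) (0, fderiv ℝ f.toFun z v) := by
  have h1 := ((contDiffAt_cutMap h (p := (0, f z)) (f.mapsTo_openDisc hz)).differentiableAt
    (n := ∞) (by simp)).hasFDerivAt
  have h2 := (hasFDerivAt_const (0 : ℝ) z).prodMk
    ((f.contDiffAt hz).differentiableAt (n := ∞) (by simp)).hasFDerivAt
  have h3 : HasFDerivAt (page h f) _ z := h1.comp z h2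
  rw [h3.fderiv]
  rfl

theorem isDiscParam_page (h : ℕ) (f : AreaDiffeo) : IsDiscParam (page h f) := by
  refine ⟨?_, ?_, ?_, ?_, ?_, hemisphere, contDiff_hemisphere.contDiffOn, ?_, ?_, ?_, ?_⟩
  · exact (continuous_cutMap h).comp_continuousOn
      (continuousOn_const.prodMk f.smooth.continuousOn)
  · intro z hz w hw e
    refine f.injOn hz hw ?_
    simp only [page, cutMap_zero, Prod.mk.injEq] at e
    exact e.2
  · exact fun z hz => cutMap_mem_sphere3 h (f.mapsTo hz)
  · exact fun z hz => (contDiffAt_page h f hz).contDiffWithinAt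
  · intro z hz v w e
    rw [fderiv_page h f hz, fderiv_page h f hz] at e
    have := fderiv_cutMap_injective h (p := (0, f z)) (f.mapsTo_openDisc hz) e
    exact f.fderiv_injective hz (congrArg Prod.snd this)
  · intro z _ w _ e
    rw [← hemisphere_leftInverse z, e, hemisphere_leftInverse w]
  · intro z hz
    rw [(contDiff_hemisphere.differentiable (by simp) z).fderivWithin (uniqueDiffOn_disc z hz)]
    exact fderiv_hemisphere_injective z
  · rw [hemisphere_image_disc h, page_image h f f.image_disc]
  · rw [hemisphere_image_circ h, page_image h f f.image_circ]

theorem cutMap_int_mem_page (h : ℕ) (f : AreaDiffeo) (n : ℤ) {z : ℂ} (hz : z ∈ openDisc) :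
    cutMap h (n * (2 * Real.pi), z) ∈ page h f '' openDisc := by
  rw [page_image h f f.image_openDisc]
  refine ⟨z, hz, ?_⟩
  have := cutMap_add_period h 0 n z
  rw [zero_add] at this
  exact this.symm

/-- The Reeb flow of the glued form realises every conjugate of `ψ`, on the same page with another
parametrisation. -/
theorem realisedBy_page {h : ℕ} {H : ℝ → ℂ → ℝ} {ψ : AreaDiffeo}
    (hψ : EmbedsByCut h H stdPrimitive AreaDiffeo.refl ψ) {δ : ℝ} {C : ℝ × ℂ → ℝ × ℂ →L[ℝ] ℝ}
    (hδ : 0 < δ) (hg : IsGluingPair h δ (hamForm H stdPrimitive) C) (f : AreaDiffeo) :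
    RealisedBy (sphereForm h (hamForm H stdPrimitive) C) (page h f) (f.conj ψ) := by
  obtain ⟨Fl, hFl, hbind, F, hF1, T, σ, hTσ, horb, horb0⟩ := exists_flow hψ
  have hoff : ∀ p ∈ sphere3 \ page h f '' circ, p.1 ≠ 0 := by
    rintro p ⟨hp, hpc⟩ hp1
    rw [page_image_circ] at hpc
    exact hpc ⟨hp1, norm_snd_eq_one_of_mem_sphere3 hp hp1⟩
  refine ⟨hg.isContactFormS3 hδ, _, Fl, isReebField hψ hδ hg, hFl,
    ⟨isDiscParam_page h f, ?_, ?_, ?_, ?_⟩, ?_⟩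
  · refine ⟨(0, 1), by simp [sphere3], 2 * Real.pi, Real.two_pi_pos, ?_, ?_⟩
    · rw [hbind, mul_one]
      exact Prod.ext rfl (by simp)
    · rw [page_image_circ]
      ext p
      constructor
      · rintro ⟨t, rfl⟩
        simp [hbind, Complex.norm_exp_ofReal_mul_I]
      · rintro ⟨h1, h2⟩
        refine ⟨Complex.arg p.2, ?_⟩
        have h3 := Complex.norm_mul_exp_arg_mul_I p.2
        rw [h2, Complex.ofReal_one, one_mul] at h3
        exact (hbind _ _).trans (Prod.ext h1.symm (by rw [mul_one]; exact h3))
  · rintro z hz ⟨v, hv⟩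
    have hfz := f.mapsTo_openDisc hz
    have hpos : 0 < reebSpeed H stdPrimitive 0 (f z) := by
      obtain ⟨c, h0, hle⟩ := exists_le_reebSpeed hψ.hamiltonian hψ.primitive hψ.contact
      exact h0.trans_le (hle 0 _ (openDisc_subset_disc hfz))
    rw [fderiv_page h f hz, page, reebField_cutMap h hψ.hamiltonian _ 0 hfz] at hv
    have h1 := congrArg Prod.fst (fderiv_cutMap_injective h (p := (0, f z)) hfz hv)
    simp only [Prod.smul_fst, smul_eq_mul, mul_one] at h1
    exact (inv_pos.2 hpos).ne h1
  · intro p hp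
    obtain ⟨s, a, ha, hfl⟩ := horb p hp.1 (hoff p hp)
    obtain ⟨hm, h1, h2⟩ := hTσ a (openDisc_subset_disc ha)
    obtain ⟨n, hn⟩ := exists_int_gt (s / (2 * Real.pi))
    rw [div_lt_iff₀ Real.two_pi_pos] at hn
    refine ⟨T a (n * (2 * Real.pi)) - T a s, sub_pos.2 (hm hn), ?_⟩
    rw [hfl, add_sub_cancel, h2]
    exact cutMap_int_mem_page h f n ((F _).mapsTo_openDisc ha)
  · intro p hp
    obtain ⟨s, a, ha, hfl⟩ := horb p hp.1 (hoff p hp)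
    obtain ⟨hm, h1, h2⟩ := hTσ a (openDisc_subset_disc ha)
    obtain ⟨n, hn⟩ := exists_int_lt (s / (2 * Real.pi))
    rw [lt_div_iff₀ Real.two_pi_pos] at hn
    refine ⟨T a (n * (2 * Real.pi)) - T a s, sub_neg.2 (hm hn), ?_⟩
    rw [hfl, add_sub_cancel, h2]
    exact cutMap_int_mem_page h f n ((F _).mapsTo_openDisc ha)
  · intro z hz
    have hfz := f.mapsTo_openDisc hz
    have hfzd := openDisc_subset_disc hfz
    obtain ⟨hm, h1, h2⟩ := hTσ (f z) hfzd
    refine ⟨(f.conj ψ).mapsTo_openDisc hz, T (f z) (2 * Real.pi) - T (f z) 0,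
      sub_pos.2 (hm Real.two_pi_pos), ?_, ?_⟩
    · have h3 : f (f.conj ψ z) = ψ (f z) := f.right_inv _ (ψ.mapsTo hfzd)
      rw [page, horb0 _ hfz, add_sub_cancel, h2, hF1 _ hfzd, page, h3]
      simpa using cutMap_add_period h 0 1 (ψ (f z))
    -- In between, the angular coordinate of the orbit lies strictly between `0` and `2π`.
    · rintro t ht0 ht1 ⟨w, hw, e⟩
      rw [page, page, horb0 _ hfz] at e
      have hs0 : 0 < σ (f z) (T (f z) 0 + t) := by
        rw [← hm.lt_iff_lt, h1]
        linarith
      have hs1 : σ (f z) (T (f z) 0 + t) < 2 * Real.pi := by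
        rw [← hm.lt_iff_lt, h1]
        linarith
      have hfw := f.mapsTo_openDisc hw
      have hfwd := openDisc_subset_disc hfw
      rcases (cutMap_eq_iff h _ _ hfwd ((F _).mapsTo hfzd)).1 e with ⟨-, n, hn⟩ | ⟨hc, -, -⟩
      · rw [zero_add] at hn
        rw [hn] at hs0 hs1
        have hn0 : (0 : ℝ) < n := by
          by_contra hcon
          nlinarith [Real.two_pi_pos]
        have hn1 : (n : ℝ) < 1 := by
          by_contra hcon
          nlinarith [Real.two_pi_pos]
        have h4 : 0 < n := by exact_mod_cast hn0
        have h5 : n < 1 := by exact_mod_cast hn1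
        omega
      · exact (mem_circ_iff hfwd).1 hc hfw

/-! ### The contact cut -/

theorem isContactCut {h : ℕ} {H : ℝ → ℂ → ℝ} {l : ℂ → ℂ →L[ℝ] ℝ} {δ : ℝ}
    {C : ℝ × ℂ → ℝ × ℂ →L[ℝ] ℝ} (hg : IsGluingPair h δ (hamForm H l) C) (f : AreaDiffeo) :
    IsContactCut h f (hamForm (fun s z => H s (f z)) (f.pullForm l))
      (sphereForm h (hamForm H l) C) (fun p => cutMap h (f.torusMap p)) := by
  have hfm : ∀ p ∈ openTorus, (f.torusMap p).2 ∈ openDisc := fun p hp => f.mapsTo_openDisc hp.2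
  have hd1 : ∀ p ∈ openTorus, DifferentiableAt ℝ f.torusMap p := fun p hp =>
    (f.contDiffAt_torusMap hp.2).differentiableAt (by simp)
  have hd2 : ∀ p ∈ openTorus, DifferentiableAt ℝ (cutMap h) (f.torusMap p) := fun p hp =>
    (contDiffAt_cutMap h (hfm p hp)).differentiableAt (n := ∞) (by simp)
  have himage : f.torusMap '' solidTorus = solidTorus := by
    refine Subset.antisymm (image_subset_iff.2 f.mapsTo_torusMap) fun p hp => ?_
    exact ⟨f.symm.torusMap p, f.symm.mapsTo_torusMap hp, Prod.ext rfl (f.right_inv _ hp.2)⟩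
  refine ⟨?_, ?_, ?_, ?_, ?_, ?_, ?_⟩
  · exact (continuous_cutMap h).comp_continuousOn f.contDiffOn_torusMap.continuousOn
  · rw [← cutMap_surj h]
    conv_rhs => rw [← himage, image_image]
  · intro s s' z hz z' hz'
    refine (cutMap_eq_iff h s s' (f.mapsTo hz) (f.mapsTo hz')).trans ?_
    rw [f.injOn.eq_iff hz hz', f.mem_circ_iff hz, f.mem_circ_iff hz']
  · exact fun p hp => ((contDiffAt_cutMap h (hfm p hp)).comp p
      (f.contDiffAt_torusMap hp.2)).contDiffWithinAt
  · intro p hp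
    have h1 : fderiv ℝ (fun p => cutMap h (f.torusMap p)) p = _ :=
      fderiv_comp p (hd2 p hp) (hd1 p hp)
    rw [h1]
    refine (fderiv_cutMap_injective h (hfm p hp)).comp ?_
    rw [← fderivWithin_of_mem_nhds (solidTorus_mem_nhds hp.2)]
    intro u v e
    have hps := openTorus_subset_solidTorus hp
    replace e := (f.fderivWithin_torusMap hps u).symm.trans
      (e.trans (f.fderivWithin_torusMap hps v))
    rw [Prod.mk.injEq] at e
    exact Prod.ext e.1 (f.fderivWithin_injective hps.2 e.2)
  · intro p hp
    rw [pull_comp (hd1 p hp) (hd2 p hp), f.hamForm_pullForm_eq_pull H l hp]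
    unfold pull
    have := hg.pull_cutMap_sphereForm (hfm p hp)
    unfold pull at this
    rw [this]
  · refine ⟨1, one_pos, le_rfl, bindMap, ?_, ?_, ?_⟩
    · rintro p ⟨-, hp⟩
      exact (contDiffAt_bindMap (by simpa using hp)).contDiffWithinAt
    · rintro p ⟨-, hp⟩
      exact fderiv_bindMap_injective (by simpa using hp)
    · intro b ρ ϑ h0 h1
      rw [bindMap_polar h h0 h1]
      refine congrArg (cutMap h) (Prod.ext rfl ?_)
      exact (f.right_inv _ (openDisc_subset_disc (ofReal_mul_exp_mem_openDisc h0 h1))).symm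

end ReebCut

end

theorem proposition4p6 (h : ℕ) (H : ℝ → ℂ → ℝ) (ψ φ : ReebCut.AreaDiffeo)
    (hψ : ReebCut.EmbedsByCut h H ReebCut.stdPrimitive ReebCut.AreaDiffeo.refl ψ) :
    ReebCut.EmbedsIntoReebFlow (φ.symm.comp (ψ.comp φ)) ∧
    ∃ (K : ℝ → ℂ → ℝ) (l : ℂ → ℂ →L[ℝ] ℝ) (g : ReebCut.AreaDiffeo),
      ReebCut.EmbedsByCut h K l g (φ.symm.comp (ψ.comp φ)) ∧
      ∃ (A : ℂ × ℂ → ℂ × ℂ →L[ℝ] ℝ) (q : ℝ × ℂ → ℂ × ℂ),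
        ReebCut.IsContactCut h g (ReebCut.hamForm K l) A q ∧
        ReebCut.RealisedBy A (fun z => q (0, z)) (φ.symm.comp (ψ.comp φ)) := by
  obtain ⟨δ, hδ, C, hg⟩ := hψ.isGluingPair
  have hr := ReebCut.realisedBy_page hψ hδ hg φ
  exact ⟨⟨_, _, hr⟩, _, _, φ, hψ.conj φ, _, _, ReebCut.isContactCut hg φ, hr⟩
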